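/- Let $1\le d\le n$ be integers, $\delta\in(0,1/2)$ and $\theta\in\mathbb R^d$. One observes $Y_i=\eta_i\theta+\xi_i$, $i=1,\dots,n$, where $(\eta_i)$ is a homogeneous Markov chain on $\{-1,1\}$ with $\eta_1$ Rademacher and $\mathbf P(\eta_{i+1}=-\eta_i\mid\eta_1,\dots,\eta_i)=\delta$, and where $\xi_1,\dots,\xi_n$ are i.i.d. random vectors, independent of $(\eta_i)$, that are isotropic ($\mathbf E[\xi_i\xi_i^{\top}]=\mathbf I_d$) and $1$-subGaussian ($\mathbf E\,e^{\langle v,\xi_i\rangle}\le e^{\|v\|^2/2}$ for all $v\in\mathbb R^d$). For $1\le\ell\le n$ put $k=\lfloor n/\ell\rfloor$ (so $n=k\ell$ if $\ell$ divides $n$; otherwise the last $n-k\ell$ observations are not used), let $\tilde Y_i=\frac1k\sum_{(i-1)k<j\le ik}Y_j$, $i=1,\dots,\ell$, be the means over $\ell$ consecutive buckets of length $k$, and let $\hat\Sigma=\frac1\ell\sum_{i=1}^{\ell}\tilde Y_i\tilde Y_i^{\top}$. Let $$\tilde\theta(\ell)=\sqrt{\left(\lambda_{\max}(\hat\Sigma)-\tfrac1k\right)_+}\;v_{\max}(\hat\Sigma),$$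 where $v_{\max}(\hat\Sigma)$ is any unit eigenvector for the largest eigenvalue $\lambda_{\max}(\hat\Sigma)$. Let $\ell(t,\theta)=\min\{\|t-\theta\|,\|t+\theta\|\}$ and $$\ell^{**}=d\vee\left\lceil n\delta\vee\frac{\delta^{2/3}n^{4/3}\|\theta\|^{4/3}}{d^{1/3}}\vee n\|\theta\|^2\right\rceil\wedge n .$$ There are absolute constants $c_0,c_1,C>0$ such that, for all such $d,n,\delta,\theta$ and all such laws of the noise, with probability at least $1-c_1e^{-c_0d}$, $\tilde\theta=\tilde\theta(\ell^{**})$ satisfies all of the following. (1) If $\delta\le\sqrt{d/n}$, then $$\ell^2(\tilde\theta,\theta)\le C\cdot\begin{cases}\sqrt{\frac{\delta d}{n}}+\frac dn, & \|\theta\|^2\le\sqrt{\frac{\delta d}{n}}\vee\frac dn,\\[2pt] \left(\frac{\delta d/n}{\|\theta\|}\right)^{2/3}, & \delta\ge\frac dn\ \text{ and }\ \sqrt{\frac{\delta d}{n}}\vee\frac dn\le\|\theta\|^2\le\frac{\delta^2n}{d}\vee\frac dn,\\[2pt] \frac dn, & \frac{\delta^2n}{d}\vee\frac dn\le\|\theta\|^2.\end{cases}$$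 (2) If $\delta\ge\sqrt{d/n}$, then $$\ell^2(\tilde\theta,\theta)\le C\cdot\begin{cases}\sqrt{\frac{\delta d}{n}}+\frac dn, & \|\theta\|^2\le\sqrt{\frac{\delta d}{n}},\\[2pt] \left(\frac{\delta d/n}{\|\theta\|}\right)^{2/3}, & \sqrt{\frac{\delta d}{n}}\le\|\theta\|^2\le\frac{\sqrt{d/n}}{\delta},\\[2pt] \frac dn+\frac{d/n}{\|\theta\|^2}, & \frac{\sqrt{d/n}}{\delta}\le\|\theta\|^2.\end{cases}$$ (3) In all cases, $\ell^2(\tilde\theta,\theta)\le C\left(\sqrt{\frac{\delta d}{n}}+\frac dn\right)$. Where ranges overlap, each of the bounds holds. -/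

import Mathlib

open MeasureTheory ProbabilityTheory

noncomputable section

namespace HiddenMarkovMixture

/-- `ℝ^d` with its Euclidean norm. -/
abbrev Vec (d : ℕ) : Type := EuclideanSpace ℝ (Fin d)

/-- A random vector `X` is `1`-subGaussian: `E exp⟨v, X⟩ ≤ exp(‖v‖² / 2)` for every `v`
(the expectation being finite). -/
def IsSubGaussianVec {Ω : Type*} [MeasurableSpace Ω] (μ : Measure Ω) {d : ℕ}
    (X : Ω → Vec d) : Prop :=
  ∀ v : Vec d, Integrable (fun ω => Real.exp (inner ℝ v (X ω))) μ ∧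
    ∫ ω, Real.exp (inner ℝ v (X ω)) ∂μ ≤ Real.exp (‖v‖ ^ 2 / 2)

/-- A random vector `X` is isotropic: `E[X Xᵀ]` is the identity matrix. -/
def IsIsotropicVec {Ω : Type*} [MeasurableSpace Ω] (μ : Measure Ω) {d : ℕ}
    (X : Ω → Vec d) : Prop :=
  ∀ a b : Fin d, Integrable (fun ω => X ω a * X ω b) μ ∧
    ∫ ω, X ω a * X ω b ∂μ = (1 : Matrix (Fin d) (Fin d) ℝ) a b

/-- `η` consists of the first `n ≥ 1` steps of the binary symmetric Markov chain on `{1, -1}` with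
flip probability `δ`, started from a Rademacher variable. -/
structure IsFlipChain {Ω : Type*} [MeasurableSpace Ω] (μ : Measure Ω) {n : ℕ} (δ : ℝ)
    (η : Fin n → Ω → ℝ) : Prop where
  measurable : ∀ i, Measurable (η i)
  sign : ∀ i ω, η i ω = 1 ∨ η i ω = -1
  law : ∀ s : ℕ → ℝ, (∀ i, s i = 1 ∨ s i = -1) →
    μ.real {ω | ∀ i : Fin n, η i ω = s i} =
      1 / 2 * ∏ i ∈ Finset.range (n - 1), (if s (i + 1) = s i then 1 - δ else δ)

/-- The noise: i.i.d. isotropic `1`-subGaussian random vectors. -/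
structure IsNoise {Ω : Type*} [MeasurableSpace Ω] (μ : Measure Ω) {n d : ℕ}
    (ξ : Fin n → Ω → Vec d) : Prop where
  measurable : ∀ i, Measurable (ξ i)
  indep : iIndepFun ξ μ
  identDistrib : ∀ i j, IdentDistrib (ξ i) (ξ j) μ μ
  isotropic : ∀ i, IsIsotropicVec μ (ξ i)
  subGaussian : ∀ i, IsSubGaussianVec μ (ξ i)

/-- The labels form a flip chain and the noise is independent of the labels. -/
structure IsModel {Ω : Type*} [MeasurableSpace Ω] (μ : Measure Ω) {n d : ℕ} (δ : ℝ)
    (η : Fin n → Ω → ℝ) (ξ : Fin n → Ω → Vec d) : Prop where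
  chain : IsFlipChain μ δ η
  noise : IsNoise μ ξ
  indep : IndepFun (fun ω i => η i ω) (fun ω i => ξ i ω) μ

/-- The observations `Y_i = η_i θ + ξ_i`. -/
def observations {Ω : Type*} {n d : ℕ} (θ : Vec d) (η : Fin n → Ω → ℝ) (ξ : Fin n → Ω → Vec d)
    (ω : Ω) (i : Fin n) : Vec d :=
  η i ω • θ + ξ i ω

/-- The length `k` of each of `ℓ` consecutive buckets; `k = n / ℓ` when `ℓ` divides `n`, and
`k = ⌊n / ℓ⌋` in general. -/
def bucketLength (n ℓ : ℕ) : ℕ := n / ℓ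

/-- The `i`-th bucket `{j | i k ≤ j < (i + 1) k}`. -/
def bucket (n ℓ : ℕ) (i : Fin ℓ) : Finset (Fin n) :=
  {j | i.val * bucketLength n ℓ ≤ j.val ∧ j.val < (i.val + 1) * bucketLength n ℓ}

/-- The `d × ℓ` matrix whose columns are the bucket means. -/
def bucketMeans {n d : ℕ} (Y : Fin n → Vec d) (ℓ : ℕ) : Matrix (Fin d) (Fin ℓ) ℝ :=
  Matrix.of fun a i => 1 / (bucketLength n ℓ : ℝ) * ∑ j ∈ bucket n ℓ i, Y j a

/-- The normalised Gram matrix of the bucket means. -/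
def sampleCov {n d : ℕ} (Y : Fin n → Vec d) (ℓ : ℕ) : Matrix (Fin d) (Fin d) ℝ :=
  (1 / (ℓ : ℝ)) • (bucketMeans Y ℓ * (bucketMeans Y ℓ).transpose)

/-- `lam` is the largest eigenvalue of `A`, and `v` is a corresponding unit eigenvector. -/
def IsTopEigenpair {d : ℕ} (A : Matrix (Fin d) (Fin d) ℝ) (lam : ℝ) (v : Vec d) : Prop :=
  IsGreatest {x : ℝ | Module.End.HasEigenvalue (Matrix.toEuclideanLin A) x} lam ∧
    ‖v‖ = 1 ∧ Matrix.toEuclideanLin A v = lam • v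

/-- `t` is a value of the estimator with `ℓ` buckets on the data `Y`, that is,
`t = √((lam - 1 / k)₊) v` for the top eigenvalue `lam` of the sample covariance and some choice of
a unit top eigenvector `v`. -/
def IsThetaTilde {n d : ℕ} (Y : Fin n → Vec d) (ℓ : ℕ) (t : Vec d) : Prop :=
  ∃ (lam : ℝ) (v : Vec d), IsTopEigenpair (sampleCov Y ℓ) lam v ∧
    t = √(max (lam - 1 / (bucketLength n ℓ : ℝ)) 0) • v

/-- The estimator has a value for every number of buckets and all data. -/
theorem exists_isThetaTilde {n d : ℕ} (hd : 1 ≤ d) (Y : Fin n → Vec d) (ℓ : ℕ) :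
    ∃ t, IsThetaTilde Y ℓ t := by
  have hA : (sampleCov Y ℓ).IsHermitian := by
    unfold sampleCov Matrix.IsHermitian
    simp [Matrix.conjTranspose_eq_transpose_of_trivial]
  have : Nonempty (Fin d) := ⟨⟨0, hd⟩⟩
  obtain ⟨i, hi⟩ := Finite.exists_max hA.eigenvalues
  have key : Matrix.toEuclideanLin (sampleCov Y ℓ) (hA.eigenvectorBasis i)
      = hA.eigenvalues i • hA.eigenvectorBasis i := by
    have := hA.mulVec_eigenvectorBasis i
    ext a
    simpa [Matrix.toLpLin_apply] using congrFun this a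
  refine ⟨_, hA.eigenvalues i, hA.eigenvectorBasis i, ⟨⟨?_, ?_⟩, ?_, key⟩, rfl⟩
  · refine Module.End.hasEigenvalue_of_hasEigenvector (x := hA.eigenvectorBasis i) ⟨?_, ?_⟩
    · exact Module.End.mem_eigenspace_iff.2 key
    · exact hA.eigenvectorBasis.orthonormal.ne_zero i
  · intro x hx
    have hx' := Module.End.HasEigenvalue.mem_spectrum hx
    rw [Matrix.spectrum_toLpLin, hA.spectrum_real_eq_range_eigenvalues] at hx'
    obtain ⟨j, rfl⟩ := hx'
    exact hi j
  · exact hA.eigenvectorBasis.orthonormal.1 i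

/-- The loss: Euclidean distance up to a global sign. -/
def loss {d : ℕ} (t θ : Vec d) : ℝ := min ‖t - θ‖ ‖t + θ‖

/-- The number of buckets
`d ∨ ⌈nδ ∨ δ^{2/3} n^{4/3} ‖θ‖^{4/3} / d^{1/3} ∨ n‖θ‖²⌉ ∧ n`. -/
def numBuckets {d : ℕ} (n : ℕ) (δ : ℝ) (θ : Vec d) : ℕ :=
  max d (min ⌈max (max (n * δ)
    (δ ^ (2 / 3 : ℝ) * (n : ℝ) ^ (4 / 3 : ℝ) * ‖θ‖ ^ (4 / 3 : ℝ) / (d : ℝ) ^ (1 / 3 : ℝ)))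
    (n * ‖θ‖ ^ 2)⌉₊ n)

end HiddenMarkovMixture

end

noncomputable section

namespace HiddenMarkovMixture

/-! ### Quadratic forms and nets of the sphere -/

section QuadraticForms

variable {E : Type*} [NormedAddCommGroup E] [InnerProductSpace ℝ E]

/-! Averaging over a bucket of length k turns the labels into a number e_i in [-1, 1], equal to ±1
unless the bucket contains a flip, and shrinks the noise covariance to I/k. Hence Σ̂ - I/k equals
θθᵀ up to three errors. The bias 1 - mean(e_i²) is at most the number of flips over ℓ, of order (nδ
+ d)/ℓ. The cross term has norm of order √(d/n), since given the labels it is a linear form in the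
noise with bounded coefficients. The noise term has operator norm of order V = √(dℓ)/n, by
Bernstein's inequality for squares of subGaussian variables. A net of at most 5^d directions makes
the last two bounds uniform, and all three hold outside an event of probability at most 4e⁻ᵈ
(`IsModel.exists_good_event`). This event does not depend on the eigenvector, so every choice of it
is covered.

If b₁, b₂, b₃ bound the three errors and r = ‖θ‖, the total error in operator norm is ε = b₁r² +
2rb₂ + b₃. Then loss² ≲ ε, and also loss²·r² ≲ ε², which is better for strong signals
(`loss_sq_le_of_quad_close`). The number of buckets is such that either ℓ = n, with no bias, or the
bias is dominated by the other terms. With q = d/n and L = loss² this leaves L ≲ V and L r² ≲ q r² +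
V² (`rate_of_perturbation`). Since V² ≤ q and V² ≲ q² + a + a^(2/3) r^(4/3) + q r² for a = δd/n,
comparing terms gives each regime (`three_rates`, `piecewise_rates`). -/

theorem abs_bilin_le_of_abs_quad_le (B : E →ₗ[ℝ] E →ₗ[ℝ] ℝ) (hB : ∀ x y, B x y = B y x) {ε : ℝ}
    (h : ∀ u, |B u u| ≤ ε * ‖u‖ ^ 2) (u v : E) : |B u v| ≤ ε * (‖u‖ * ‖v‖) := by
  by_cases hu : u = 0
  · simp [hu]
  by_cases hv : v = 0
  · simp [hv]
  have hu' := norm_pos_iff.2 hu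
  have hv' := norm_pos_iff.2 hv
  -- Polarisation after scaling both vectors to the common norm ‖u‖‖v‖, so that the parallelogram
  -- law gives a product of norms.
  have h1 := h (‖v‖ • u + ‖u‖ • v)
  have h2 := h (‖v‖ • u - ‖u‖ • v)
  have hpar := parallelogram_law_with_norm ℝ (‖v‖ • u) (‖u‖ • v)
  have e : B (‖v‖ • u + ‖u‖ • v) (‖v‖ • u + ‖u‖ • v) - B (‖v‖ • u - ‖u‖ • v) (‖v‖ • u - ‖u‖ • v)
      = 4 * (‖u‖ * ‖v‖) * B u v := by
    simp only [map_add, map_sub, LinearMap.add_apply, LinearMap.sub_apply, map_smul,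
      LinearMap.smul_apply, smul_eq_mul, hB v u]
    ring
  have hn1 : ‖‖v‖ • u‖ = ‖u‖ * ‖v‖ := by rw [norm_smul, norm_norm, mul_comm]
  have hn2 : ‖‖u‖ • v‖ = ‖u‖ * ‖v‖ := by rw [norm_smul, norm_norm]
  rw [hn1, hn2] at hpar
  have hsum : |4 * (‖u‖ * ‖v‖) * B u v| ≤ ε * (4 * (‖u‖ * ‖v‖) ^ 2) := by
    rw [← e]
    refine (abs_sub _ _).trans ((add_le_add h1 h2).trans (le_of_eq ?_))
    linear_combination ε * hpar
  rw [abs_mul, abs_of_pos (by positivity)] at hsum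
  have hp : 0 < 4 * (‖u‖ * ‖v‖) := by positivity
  refine le_of_mul_le_mul_left ?_ hp
  linarith

/-- Let w maximise |B(w, w)| = S on the sphere and let x be a net point near w. Then B(w, w) - B(x,
x) = B(w - x, w + x) is at most S‖w - x‖‖w + x‖ by polarisation. As ‖w - x‖² + ‖w + x‖² = 4 and ‖w -
x‖ ≤ 1/2, the product of norms is at most √15/4 < 31/32, whence S ≤ 32ε. -/
theorem abs_quad_le_of_net [FiniteDimensional ℝ E] (B : E →ₗ[ℝ] E →ₗ[ℝ] ℝ)
    (hB : ∀ x y, B x y = B y x) (N : Set E)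
    (hN1 : ∀ x ∈ N, ‖x‖ = 1) (hN2 : ∀ u, ‖u‖ = 1 → ∃ x ∈ N, ‖u - x‖ ≤ 1 / 2) {ε : ℝ}
    (h : ∀ x ∈ N, |B x x| ≤ ε) (u : E) : |B u u| ≤ 32 * ε * ‖u‖ ^ 2 := by
  have scale : ∀ S : ℝ, (∀ w : E, ‖w‖ = 1 → |B w w| ≤ S) → ∀ w : E, |B w w| ≤ S * ‖w‖ ^ 2 := by
    intro S hS w
    by_cases hw : w = 0
    · simp [hw]
    have hw' := norm_pos_iff.2 hw
    have := hS (‖w‖⁻¹ • w) (by rw [norm_smul, norm_inv, norm_norm, inv_mul_cancel₀ hw'.ne'])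
    simp only [map_smul, LinearMap.smul_apply, smul_eq_mul, ← mul_assoc, abs_mul, abs_inv,
      abs_norm] at this
    calc |B w w| = (‖w‖⁻¹ * ‖w‖⁻¹ * |B w w|) * ‖w‖ ^ 2 := by field_simp
      _ ≤ _ := by gcongr
  by_cases hu : u = 0
  · simp [hu]
  have hcont : Continuous fun w : E => |B w w| := by
    have h1 : Continuous fun w : E => B.toContinuousBilinearMap w w := by fun_prop
    exact h1.abs
  have hne : (Metric.sphere (0 : E) 1).Nonempty :=
    ⟨‖u‖⁻¹ • u, by
      simp [norm_smul, inv_mul_cancel₀ (norm_pos_iff.2 hu).ne']⟩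
  obtain ⟨w, hw, hmax⟩ := (isCompact_sphere (0 : E) 1).exists_isMaxOn hne hcont.continuousOn
  have hw1 : ‖w‖ = 1 := by simpa using hw
  have hS : ∀ z : E, ‖z‖ = 1 → |B z z| ≤ |B w w| := fun z hz => hmax (by simpa using hz)
  obtain ⟨x, hx, hwx⟩ := hN2 w hw1
  have hpol := abs_bilin_le_of_abs_quad_le B hB (scale _ hS) (w - x) (w + x)
  have e : B (w - x) (w + x) = B w w - B x x := by
    simp only [map_add, map_sub, LinearMap.sub_apply, hB x w]; ring
  have hpar := parallelogram_law_with_norm ℝ w x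
  rw [hw1, hN1 x hx] at hpar
  have hprod : ‖w - x‖ * ‖w + x‖ ≤ 31 / 32 := by
    nlinarith [norm_nonneg (w - x), norm_nonneg (w + x),
      mul_nonneg (norm_nonneg (w - x)) (norm_nonneg (w + x)), 
      mul_self_nonneg (‖w - x‖ ^ 2 - 1/4), mul_self_nonneg (‖w - x‖ * ‖w + x‖ - 31/32),
      mul_nonneg (sub_nonneg.2 hwx) (add_nonneg (norm_nonneg (w - x)) (by norm_num : (0:ℝ) ≤ 1/2))]
  rw [e] at hpol
  have h3 : |B w w| ≤ |B w w - B x x| + |B x x| := by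
    simpa using abs_add_le (B w w - B x x) (B x x)
  have h4 : |B w w| * (‖w - x‖ * ‖w + x‖) ≤ |B w w| * (31 / 32) :=
    mul_le_mul_of_nonneg_left hprod (abs_nonneg _)
  have h5 := h x hx
  exact scale _ (fun z hz => (hS z hz).trans (by linarith)) u

theorem norm_le_of_net (N : Set E)
    (hN2 : ∀ u, ‖u‖ = 1 → ∃ x ∈ N, ‖u - x‖ ≤ 1 / 2) {ε : ℝ} (hε : 0 ≤ ε) (w : E)
    (h : ∀ x ∈ N, inner ℝ x w ≤ ε) : ‖w‖ ≤ 2 * ε := by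
  by_cases hw : w = 0
  · simp [hw, hε]
  have hw' := norm_pos_iff.2 hw
  obtain ⟨x, hx, hwx⟩ := hN2 (‖w‖⁻¹ • w)
    (by rw [norm_smul, norm_inv, norm_norm, inv_mul_cancel₀ hw'.ne'])
  have h1 : inner ℝ (‖w‖⁻¹ • w) w = ‖w‖ := by
    rw [real_inner_smul_left, real_inner_self_eq_norm_sq]; field_simp
  have h2 : inner ℝ (‖w‖⁻¹ • w - x) w ≤ 1 / 2 * ‖w‖ :=
    (real_inner_le_norm _ _).trans (by gcongr)
  rw [inner_sub_left, h1] at h2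
  linarith [h x hx]

/-- A 1/2-separated subset of the sphere of maximal cardinality is a net. Doubling it gives a
1-separated set in the ball of radius 2, to which the volume bound 5^d of
`Besicovitch.card_le_of_separated` applies. -/
theorem exists_sphere_net (E : Type*) [NormedAddCommGroup E] [InnerProductSpace ℝ E]
    [FiniteDimensional ℝ E] : ∃ N : Finset E, N.card ≤ 5 ^ Module.finrank ℝ E ∧
      (∀ x ∈ N, ‖x‖ = 1) ∧ ∀ u, ‖u‖ = 1 → ∃ x ∈ N, ‖u - x‖ ≤ 1 / 2 := by
  classical
  let P : ℕ → Prop := fun m => ∃ s : Finset E, s.card = m ∧ (∀ x ∈ s, ‖x‖ = 1) ∧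
    ∀ x ∈ s, ∀ y ∈ s, x ≠ y → 1 / 2 ≤ ‖x - y‖
  have hP : ∀ s : Finset E, (∀ x ∈ s, ‖x‖ = 1) → (∀ x ∈ s, ∀ y ∈ s, x ≠ y → 1 / 2 ≤ ‖x - y‖) →
      s.card ≤ 5 ^ Module.finrank ℝ E := by
    intro s h1 h2
    have hinj : Function.Injective fun x : E => (2 : ℝ) • x :=
      smul_right_injective E two_ne_zero
    rw [← Finset.card_image_of_injective s hinj]
    apply Besicovitch.card_le_of_separated
    · simp only [Finset.mem_image, forall_exists_index, and_imp]
      rintro _ x hx rfl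
      simp [norm_smul, h1 x hx]
    · simp only [Finset.mem_image, forall_exists_index, and_imp]
      rintro _ x hx rfl _ y hy rfl hxy
      rw [← smul_sub, norm_smul, Real.norm_of_nonneg zero_le_two]
      linarith [h2 x hx y hy (fun h => hxy (by rw [h]))]
  obtain ⟨s, hs, h1, h2⟩ := Nat.findGreatest_spec (P := P) (n := 5 ^ Module.finrank ℝ E)
    (Nat.zero_le _) ⟨∅, by simp⟩
  refine ⟨s, hP s h1 h2, h1, fun u hu => ?_⟩
  by_contra! hcon
  have hus : u ∉ s := fun h => by
    have := hcon u h
    norm_num at this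
  have h1' : ∀ x ∈ insert u s, ‖x‖ = 1 := by simpa [hu] using h1
  have h2' : ∀ x ∈ insert u s, ∀ y ∈ insert u s, x ≠ y → 1 / 2 ≤ ‖x - y‖ := by
    intro x hx y hy hxy
    rcases Finset.mem_insert.1 hx with h | h <;> rcases Finset.mem_insert.1 hy with h' | h'
    · exact absurd (h.trans h'.symm) hxy
    · rw [h]; exact (hcon y h').le
    · rw [h', norm_sub_rev]; exact (hcon x h).le
    · exact h2 x h y h' hxy
  have := Nat.le_findGreatest (P := P) (hP _ h1' h2') ⟨_, rfl, h1', h2'⟩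
  rw [Finset.card_insert_of_notMem hus] at this
  omega

end QuadraticForms

/-! ### From a spectral perturbation to the loss -/

theorem loss_neg_right {d : ℕ} (t θ : Vec d) : loss t (-θ) = loss t θ := by
  simp [loss, min_comm, ← sub_eq_add_neg]

theorem loss_sq_le {d : ℕ} (t θ : Vec d) : loss t θ ^ 2 ≤ ‖t - θ‖ ^ 2 :=
  pow_le_pow_left₀ (le_min (norm_nonneg _) (norm_nonneg _)) (min_le_left _ _) 2

/-- Perturbation of the best rank one approximation of `θ θᵀ`. -/
theorem loss_sq_le_of_quad_close {d : ℕ} (B : Vec d →ₗ[ℝ] Vec d →ₗ[ℝ] ℝ)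
    (hB : ∀ x y, B x y = B y x) (θ v : Vec d) (hv : ‖v‖ = 1) {lam ε : ℝ}
    (hmax : ∀ u, B u u ≤ lam * ‖u‖ ^ 2) (heig : ∀ u, B v u = lam * inner ℝ v u)
    (happ : ∀ u, |B u u - inner ℝ θ u ^ 2| ≤ ε * ‖u‖ ^ 2) :
    loss (√(max lam 0) • v) θ ^ 2 ≤ 3 * ε ∧
      loss (√(max lam 0) • v) θ ^ 2 * ‖θ‖ ^ 2 ≤ 24 * ε ^ 2 := by
  wlog hc : 0 ≤ inner ℝ θ v generalizing θ
  · have := this (-θ) (by simpa [inner_neg_left] using happ)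
      (by rw [inner_neg_left]; linarith)
    simpa [loss_neg_right] using this
  have hε : 0 ≤ ε := by
    have := (abs_nonneg _).trans (happ v)
    simpa [hv] using this
  set c : ℝ := inner ℝ θ v with hcdef
  set a : ℝ := √(max lam 0) with ha
  have ha0 : 0 ≤ a := Real.sqrt_nonneg _
  have ha2 : a ^ 2 = max lam 0 := Real.sq_sqrt (le_max_right _ _)
  set w : Vec d := θ - c • v with hw
  have hvv : inner ℝ v v = (1 : ℝ) := by rw [real_inner_self_eq_norm_sq, hv]; norm_num
  have hvw : inner ℝ v w = (0 : ℝ) := by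
    rw [hw, inner_sub_right, real_inner_smul_right, hvv, real_inner_comm, mul_one, sub_self]
  have hθ : θ = c • v + w := by rw [hw]; abel
  have hθw : inner ℝ θ w = ‖w‖ ^ 2 := by
    conv_lhs => rw [hθ]
    rw [inner_add_left, real_inner_smul_left, hvw, real_inner_self_eq_norm_sq]; ring
  have hpyth : ‖θ‖ ^ 2 = c ^ 2 + ‖w‖ ^ 2 := by
    rw [← real_inner_self_eq_norm_sq θ]
    conv_lhs => rw [hθ]
    rw [inner_add_left, inner_add_right, inner_add_right, real_inner_smul_left,
      real_inner_smul_right, real_inner_smul_left, real_inner_smul_right, hvv, hvw,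
      real_inner_comm v w, hvw, real_inner_self_eq_norm_sq]; ring
  have hdist : ‖a • v - θ‖ ^ 2 = (a - c) ^ 2 + ‖w‖ ^ 2 := by
    have : a • v - θ = (a - c) • v - w := by rw [hw, sub_smul]; abel
    rw [this, norm_sub_sq_real, real_inner_smul_left, hvw, norm_smul, hv, Real.norm_eq_abs]
    rw [mul_one, sq_abs]; ring
  -- Testing the approximation at v gives lam ≈ c², and testing it at θ gives lam ≥ ‖θ‖² - ε.
  -- Together they bound ‖w‖² = ‖θ‖² - c² by 2ε.
  have hlamv : |lam - c ^ 2| ≤ ε := by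
    have := happ v
    rwa [heig v, hvv, hv, ← hcdef, one_pow, mul_one, mul_one] at this
  have hlam1 : ‖θ‖ ^ 2 - ε ≤ lam := by
    by_cases h0 : θ = 0
    · have : c = 0 := by rw [hcdef, h0, inner_zero_left]
      rw [h0, norm_zero]
      rw [this] at hlamv
      have := (abs_le.1 hlamv).1
      linarith
    · have h1 := hmax θ
      have h2 := (abs_le.1 (happ θ)).1
      rw [real_inner_self_eq_norm_sq] at h2
      have hp : 0 < ‖θ‖ ^ 2 := by have := norm_pos_iff.2 h0; positivity
      refine le_of_mul_le_mul_right ?_ hp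
      nlinarith
  have hw2 : ‖w‖ ^ 2 ≤ 2 * ε := by
    have := (abs_le.1 hlamv).2
    linarith
  have hac : |a ^ 2 - c ^ 2| ≤ ε := by
    rw [ha2, abs_le]
    obtain ⟨h1, h2⟩ := abs_le.1 hlamv
    refine ⟨by linarith [le_max_left lam 0], ?_⟩
    rcases max_cases lam 0 with ⟨h, _⟩ | ⟨h, _⟩ <;> rw [h] <;> nlinarith [sq_nonneg c]
  obtain ⟨hac1, hac2⟩ := abs_le.1 hac
  have hsq : (a - c) ^ 2 ≤ ε := by
    rcases le_total a c with h | h <;> nlinarith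
  have first : loss (a • v) θ ^ 2 ≤ 3 * ε := by
    refine (loss_sq_le _ _).trans ?_
    rw [hdist]; linarith
  refine ⟨first, ?_⟩
  -- For a weak signal the second bound follows from the first. Otherwise c² ≥ ‖θ‖² - 2ε ≥
  -- (3/4)‖θ‖², and it suffices to bound c‖w‖ and c|a - c| by ε.
  rcases le_total (‖θ‖ ^ 2) (8 * ε) with h8 | h8
  · calc loss (a • v) θ ^ 2 * ‖θ‖ ^ 2 ≤ (3 * ε) * (8 * ε) := by gcongr
      _ = 24 * ε ^ 2 := by ring
  have hcbig : 3 / 4 * ‖θ‖ ^ 2 ≤ c ^ 2 := by linarith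
  -- The eigenvector v satisfies B(v, w) = 0 because w ⊥ v, so the polarised error at (v, w) is
  -- exactly c‖w‖².
  have hcw : c * ‖w‖ ≤ ε := by
    let B' : Vec d →ₗ[ℝ] Vec d →ₗ[ℝ] ℝ := B - LinearMap.mk₂ ℝ (fun x y => inner ℝ θ x * inner ℝ θ y)
      (by intros; simp [inner_add_right, add_mul]) (by intros; simp [real_inner_smul_right, mul_assoc])
      (by intros; simp [inner_add_right, mul_add])
      (by intros; simp [real_inner_smul_right, mul_left_comm])
    have hB'val : ∀ x y, B' x y = B x y - inner ℝ θ x * inner ℝ θ y := fun x y => by simp [B']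
    have hpol := abs_bilin_le_of_abs_quad_le B' (fun x y => by rw [hB'val, hB'val, hB x y, mul_comm])
      (ε := ε) (fun u => by rw [hB'val, ← sq]; exact happ u) v w
    rw [hB'val, heig w, hvw, hθw, ← hcdef, hv, one_mul] at hpol
    by_cases hw0 : ‖w‖ = 0
    · rw [hw0, mul_zero]; exact hε
    have hwp : 0 < ‖w‖ := lt_of_le_of_ne (norm_nonneg _) (Ne.symm hw0)
    refine le_of_mul_le_mul_right ?_ hwp
    have := (abs_le.1 hpol).1
    nlinarith
  have hca : c ^ 2 * (a - c) ^ 2 ≤ ε ^ 2 := by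
    have : (a ^ 2 - c ^ 2) ^ 2 ≤ ε ^ 2 := sq_le_sq' hac1 hac2
    calc c ^ 2 * (a - c) ^ 2 ≤ (a + c) ^ 2 * (a - c) ^ 2 := by gcongr; linarith
      _ = (a ^ 2 - c ^ 2) ^ 2 := by ring
      _ ≤ _ := this
  have hcw2 : c ^ 2 * ‖w‖ ^ 2 ≤ ε ^ 2 := by
    rw [← mul_pow]; exact pow_le_pow_left₀ (by positivity) hcw 2
  have hl := loss_sq_le (a • v) θ
  rw [hdist] at hl
  calc loss (a • v) θ ^ 2 * ‖θ‖ ^ 2 ≤ ((a - c) ^ 2 + ‖w‖ ^ 2) * (4 / 3 * c ^ 2) := by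
        gcongr; linarith
    _ ≤ 24 * ε ^ 2 := by nlinarith

/-! ### The sample covariance of the bucket means -/

/-- The mean of a family over the `i`-th bucket. -/
def bucketAvg {V : Type*} [AddCommGroup V] [Module ℝ V] {n : ℕ} (ℓ : ℕ) (y : Fin n → V)
    (i : Fin ℓ) : V :=
  (1 / (bucketLength n ℓ : ℝ)) • ∑ j ∈ bucket n ℓ i, y j

theorem bucketMeans_apply {n d : ℕ} (Y : Fin n → Vec d) (ℓ : ℕ) (a : Fin d) (i : Fin ℓ) :
    bucketMeans Y ℓ a i = bucketAvg ℓ Y i a := by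
  simp [bucketMeans, bucketAvg]

theorem isHermitian_sampleCov {n d : ℕ} (Y : Fin n → Vec d) (ℓ : ℕ) :
    (sampleCov Y ℓ).IsHermitian := by
  unfold sampleCov Matrix.IsHermitian
  simp [Matrix.conjTranspose_eq_transpose_of_trivial]

theorem inner_eq_sum {d : ℕ} (x y : Vec d) : inner ℝ x y = ∑ a, x a * y a := by
  simp [PiLp.inner_apply, mul_comm]

theorem inner_toEuclideanLin_sampleCov {n d : ℕ} (Y : Fin n → Vec d) (ℓ : ℕ) (u w : Vec d) :
    inner ℝ (Matrix.toEuclideanLin (sampleCov Y ℓ) u) w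
      = 1 / (ℓ : ℝ) * ∑ i, inner ℝ (bucketAvg ℓ Y i) u * inner ℝ (bucketAvg ℓ Y i) w := by
  have h : ∀ a, Matrix.toEuclideanLin (sampleCov Y ℓ) u a
      = 1 / (ℓ : ℝ) * ∑ i, bucketAvg ℓ Y i a * inner ℝ (bucketAvg ℓ Y i) u := by
    intro a
    simp only [Matrix.toLpLin_apply, sampleCov, Matrix.smul_mulVec, Matrix.mulVec, dotProduct,
      Pi.smul_apply, smul_eq_mul, Matrix.mul_apply, Matrix.transpose_apply,
      bucketMeans_apply, inner_eq_sum]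
    congr 1
    simp_rw [Finset.sum_mul, Finset.mul_sum]
    rw [Finset.sum_comm]
    simp_rw [mul_assoc]
  rw [inner_eq_sum]
  simp_rw [h, mul_assoc, ← Finset.mul_sum, Finset.sum_mul]
  rw [Finset.sum_comm]
  congr 1
  refine Finset.sum_congr rfl fun i _ => ?_
  rw [inner_eq_sum (bucketAvg ℓ Y i) w, Finset.mul_sum]
  refine Finset.sum_congr rfl fun a _ => by ring

/-- In finite dimension the supremum of the Rayleigh quotient of a symmetric operator is an
eigenvalue, hence at most lam. The real supremum dominates its members only if they are bounded
above, which the operator norm ensures. -/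
theorem inner_le_of_isTopEigenpair {d : ℕ} {A : Matrix (Fin d) (Fin d) ℝ} (hA : A.IsHermitian)
    {lam : ℝ} {v : Vec d} (h : IsTopEigenpair A lam v) (u : Vec d) :
    inner ℝ (Matrix.toEuclideanLin A u) u ≤ lam * ‖u‖ ^ 2 := by
  by_cases hu : u = 0
  · simp [hu]
  have : Nontrivial (Vec d) := ⟨u, 0, hu⟩
  have hT : (Matrix.toEuclideanLin A).IsSymmetric := Matrix.isSymmetric_toEuclideanLin_iff.2 hA
  have htop := h.1.2 hT.hasEigenvalue_iSup_of_finiteDimensional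
  have hbdd : BddAbove (Set.range fun x : {x : Vec d // x ≠ 0} =>
      RCLike.re (inner ℝ (Matrix.toEuclideanLin A (x : Vec d)) (x : Vec d) : ℝ) / ‖(x : Vec d)‖ ^ 2) := by
    refine ⟨‖(Matrix.toEuclideanLin A).toContinuousLinearMap‖, ?_⟩
    rintro _ ⟨⟨x, hx⟩, rfl⟩
    have hx' := norm_pos_iff.2 hx
    rw [div_le_iff₀ (by positivity)]
    refine (real_inner_le_norm (Matrix.toEuclideanLin A x) x).trans ?_
    rw [sq, ← mul_assoc]
    gcongr
    exact (Matrix.toEuclideanLin A).toContinuousLinearMap.le_opNorm x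
  have h1 := (le_ciSup hbdd ⟨u, hu⟩).trans htop
  have hu' := norm_pos_iff.2 hu
  rw [div_le_iff₀ (by positivity)] at h1
  exact h1

theorem bucketAvg_observations {Ω : Type*} {n d : ℕ} (θ : Vec d) (η : Fin n → Ω → ℝ)
    (ξ : Fin n → Ω → Vec d) (ω : Ω) (ℓ : ℕ) (i : Fin ℓ) :
    bucketAvg ℓ (observations θ η ξ ω) i
      = bucketAvg ℓ (fun j => η j ω) i • θ + bucketAvg ℓ (fun j => ξ j ω) i := by
  simp only [bucketAvg, observations, Finset.sum_add_distrib, smul_add, ← Finset.sum_smul,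
    smul_assoc]

/-- The bias, cross and noise terms of the sample covariance control the loss. -/
theorem loss_sq_le_of_isThetaTilde {Ω : Type*} {n d : ℕ} (θ : Vec d) (η : Fin n → Ω → ℝ)
    (ξ : Fin n → Ω → Vec d) (ω : Ω) (ℓ : ℕ) {b₁ b₂ b₃ : ℝ}
    (h₁ : |1 - 1 / (ℓ : ℝ) * ∑ i : Fin ℓ, bucketAvg ℓ (fun j => η j ω) i ^ 2| ≤ b₁)
    (h₂ : ‖(1 / (ℓ : ℝ)) • ∑ i : Fin ℓ, bucketAvg ℓ (fun j => η j ω) i •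
      bucketAvg ℓ (fun j => ξ j ω) i‖ ≤ b₂)
    (h₃ : ∀ u : Vec d, |1 / (ℓ : ℝ) * ∑ i : Fin ℓ, inner ℝ (bucketAvg ℓ (fun j => ξ j ω) i) u ^ 2
      - 1 / (bucketLength n ℓ : ℝ) * ‖u‖ ^ 2| ≤ b₃ * ‖u‖ ^ 2)
    {t : Vec d} (ht : IsThetaTilde (observations θ η ξ ω) ℓ t) :
    loss t θ ^ 2 ≤ 3 * (b₁ * ‖θ‖ ^ 2 + 2 * ‖θ‖ * b₂ + b₃) ∧
      loss t θ ^ 2 * ‖θ‖ ^ 2 ≤ 24 * (b₁ * ‖θ‖ ^ 2 + 2 * ‖θ‖ * b₂ + b₃) ^ 2 := by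
  obtain ⟨lam, v, hv, rfl⟩ := ht
  set Y := observations θ η ξ ω with hY
  set k : ℝ := 1 / (bucketLength n ℓ : ℝ) with hk
  set T := Matrix.toEuclideanLin (sampleCov Y ℓ) with hT
  -- The form of Σ̂ - I/k: the shift removes the mean of the noise part, keeps the eigenvectors and
  -- moves the top eigenvalue to lam - 1/k.
  let B : Vec d →ₗ[ℝ] Vec d →ₗ[ℝ] ℝ := LinearMap.mk₂ ℝ
    (fun x y => inner ℝ (T x) y - k * inner ℝ x y)
    (by intros; simp only [map_add, inner_add_left]; ring)
    (by intros; simp only [map_smul, real_inner_smul_left, smul_eq_mul]; ring)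
    (by intros; simp only [inner_add_right]; ring)
    (by intros; simp only [real_inner_smul_right, smul_eq_mul]; ring)
  have hBval : ∀ x y, B x y = inner ℝ (T x) y - k * inner ℝ x y := fun x y => by simp [B]
  refine loss_sq_le_of_quad_close B ?_ θ v hv.2.1 ?_ ?_ ?_
  · intro x y
    simp only [hBval, hT, inner_toEuclideanLin_sampleCov, real_inner_comm x y]
    simp_rw [mul_comm]
  · intro u
    have := inner_le_of_isTopEigenpair (isHermitian_sampleCov Y ℓ) hv u
    rw [hBval, real_inner_self_eq_norm_sq]
    linarith
  · intro u
    rw [hBval, hT, hv.2.2, real_inner_smul_left]; ring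
  · intro u
    rw [hBval, hT, inner_toEuclideanLin_sampleCov, real_inner_self_eq_norm_sq]
    set e := bucketAvg ℓ (fun j => η j ω) with he
    set x := bucketAvg ℓ (fun j => ξ j ω) with hx
    set c := inner ℝ θ u with hc
    have hsum : 1 / (ℓ : ℝ) * ∑ i, inner ℝ (bucketAvg ℓ Y i) u * inner ℝ (bucketAvg ℓ Y i) u
        = (1 / (ℓ : ℝ) * ∑ i, e i ^ 2) * c ^ 2
          + 2 * c * inner ℝ ((1 / (ℓ : ℝ)) • ∑ i, e i • x i) u
          + 1 / (ℓ : ℝ) * ∑ i, inner ℝ (x i) u ^ 2 := by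
      simp only [hY, bucketAvg_observations, ← he, ← hx, inner_add_left, real_inner_smul_left,
        sum_inner, ← hc]
      simp only [Finset.mul_sum, Finset.sum_mul, ← Finset.sum_add_distrib]
      refine Finset.sum_congr rfl fun i _ => by ring
    rw [hsum]
    have hcle : |c| ≤ ‖θ‖ * ‖u‖ := abs_real_inner_le_norm _ _
    have hx2 : |inner ℝ ((1 / (ℓ : ℝ)) • ∑ i, e i • x i) u| ≤ b₂ * ‖u‖ :=
      (abs_real_inner_le_norm _ _).trans (by gcongr)
    set A := 1 / (ℓ : ℝ) * ∑ i, e i ^ 2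
    set D := inner ℝ ((1 / (ℓ : ℝ)) • ∑ i, e i • x i) u
    set F := 1 / (ℓ : ℝ) * ∑ i, inner ℝ (x i) u ^ 2 - k * ‖u‖ ^ 2 with hF
    have hb1 : 0 ≤ b₁ := (abs_nonneg _).trans h₁
    have hb2 : 0 ≤ b₂ := (norm_nonneg _).trans h₂
    have e1 : A * c ^ 2 + 2 * c * D + 1 / (ℓ : ℝ) * ∑ i, inner ℝ (x i) u ^ 2 - k * ‖u‖ ^ 2 - c ^ 2
        = -((1 - A) * c ^ 2) + 2 * c * D + F := by rw [hF]; ring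
    rw [e1]
    have g1 : |-((1 - A) * c ^ 2)| ≤ b₁ * (‖θ‖ * ‖u‖) ^ 2 := by
      rw [abs_neg, abs_mul, abs_pow]; gcongr
    have g2 : |2 * c * D| ≤ 2 * (‖θ‖ * ‖u‖) * (b₂ * ‖u‖) := by
      rw [abs_mul, abs_mul, abs_two]; gcongr
    calc _ ≤ |-((1 - A) * c ^ 2)| + |2 * c * D| + |F| := abs_add_three _ _ _
      _ ≤ b₁ * (‖θ‖ * ‖u‖) ^ 2 + 2 * (‖θ‖ * ‖u‖) * (b₂ * ‖u‖) + b₃ * ‖u‖ ^ 2 := by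
        gcongr; exact h₃ u
      _ = _ := by ring

/-! ### Balancing the errors -/

/-- Balancing bias, cross term and noise; `V = √(dℓ) / n` is the size of the noise term and
`q = d / n`. -/
theorem rate_of_perturbation {d n l r δ b₁ b₂ b₃ c L : ℝ} (hd : 0 < d) (hdl : d ≤ l) (hn : 0 < n)
    (hr : 0 ≤ r) (hc : 1 ≤ c) (hb₁ : 0 ≤ b₁) (hb₁' : b₁ ≤ 1)
    (hb₂ : 0 ≤ b₂) (hb₂' : b₂ ≤ c * √(d / n)) (hb₃ : 0 ≤ b₃) (hb₃' : b₃ ≤ c * (√(d * l) / n))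
    (hbias : b₁ = 0 ∨ b₁ ≤ c * ((n * δ + d) / l) ∧ n ^ 4 * δ ^ 2 * r ^ 4 ≤ d * l ^ 3 ∧
      n * r ^ 2 ≤ l)
    (h1 : L ≤ 3 * (b₁ * r ^ 2 + 2 * r * b₂ + b₃))
    (h2 : L * r ^ 2 ≤ 24 * (b₁ * r ^ 2 + 2 * r * b₂ + b₃) ^ 2) :
    L ≤ 864 * c ^ 2 * (√(d * l) / n) ∧
      L * r ^ 2 ≤ 864 * c ^ 2 * (d / n * r ^ 2 + d * l / n ^ 2) := by
  have hl : 0 < l := hd.trans_le hdl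
  set V := √(d * l) / n with hV
  set p := √(d / n) with hp
  have hV0 : 0 < V := by positivity
  have hV2 : V ^ 2 = d * l / n ^ 2 := by rw [hV, div_pow, Real.sq_sqrt (by positivity)]
  have hp0 : 0 < p := by positivity
  have hp2 : p ^ 2 = d / n := Real.sq_sqrt (by positivity)
  have hqV : d / n ≤ V := by
    refine le_of_sq_le_sq ?_ hV0.le
    rw [hV2, div_pow]; gcongr; nlinarith
  set ε := b₁ * r ^ 2 + 2 * r * b₂ + b₃ with hε
  have hε0 : 0 ≤ ε := by positivity
  rw [← hV2, ← hp2]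
  have hc2 : c ≤ c ^ 2 := by nlinarith
  -- For r² ≤ V the trivial bound b₁ ≤ 1 suffices: all three terms of ε are of order V, as d/n ≤ V.
  rcases le_total (r ^ 2) V with hrV | hrV
  · have hrp : r * p ≤ V := by
      refine le_of_sq_le_sq ?_ hV0.le
      rw [mul_pow, hp2, sq V]; gcongr
    have hεV : ε ≤ 4 * c * V := by
      have e1 : b₁ * r ^ 2 ≤ 1 * V := by gcongr
      have e2 : r * b₂ ≤ c * V := by
        calc r * b₂ ≤ r * (c * p) := by gcongr
          _ = c * (r * p) := by ring
          _ ≤ c * V := by gcongr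
      nlinarith
    have hε2 : ε ^ 2 ≤ (4 * c * V) ^ 2 := by gcongr
    have hcV : c * V ≤ c ^ 2 * V := by gcongr
    have hpos : 0 ≤ c ^ 2 * (p ^ 2 * r ^ 2) := by positivity
    have hpos2 : 0 ≤ c ^ 2 * V := by positivity
    have hpos3 : 0 ≤ c ^ 2 * V ^ 2 := by positivity
    constructor
    · linarith
    · nlinarith
  · have hr2 : 0 < r ^ 2 := hV0.trans_le hrV
    -- The bias splits in two: the part nδ/l is absorbed by V through the condition on l³, and the
    -- part d/l, from the deviation of the flip count, is absorbed by the cross term through n r² ≤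
    -- l.
    have hb : (b₁ * r ^ 2) ^ 2 ≤ 2 * c ^ 2 * (p ^ 2 * r ^ 2 + V ^ 2) := by
      rcases hbias with h0 | ⟨hb, hl3, hnr⟩
      · rw [h0, zero_mul, zero_pow two_ne_zero]; positivity
      · have e1 : (n * δ / l * r ^ 2) ^ 2 ≤ V ^ 2 := by
          rw [hV2, div_mul_eq_mul_div, div_pow, div_le_div_iff₀ (by positivity) (by positivity)]
          calc (n * δ * r ^ 2) ^ 2 * n ^ 2 = n ^ 4 * δ ^ 2 * r ^ 4 := by ring
            _ ≤ d * l ^ 3 := hl3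
            _ = _ := by ring
        have e2 : (d / l * r ^ 2) ^ 2 ≤ p ^ 2 * r ^ 2 := by
          rw [hp2, div_mul_eq_mul_div, div_mul_eq_mul_div, div_pow,
            div_le_div_iff₀ (by positivity) (by positivity)]
          have : d * (n * r ^ 2) ≤ l * l := by gcongr
          calc (d * r ^ 2) ^ 2 * n = d * r ^ 2 * (d * (n * r ^ 2)) := by ring
            _ ≤ d * r ^ 2 * (l * l) := by gcongr
            _ = _ := by ring
        have e3 : b₁ * r ^ 2 ≤ c * (n * δ / l * r ^ 2 + d / l * r ^ 2) := by
          calc b₁ * r ^ 2 ≤ c * ((n * δ + d) / l) * r ^ 2 := by gcongr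
            _ = _ := by ring
        have e4 : (b₁ * r ^ 2) ^ 2 ≤ (c * (n * δ / l * r ^ 2 + d / l * r ^ 2)) ^ 2 := by gcongr
        have e5 : (n * δ / l * r ^ 2 + d / l * r ^ 2) ^ 2 ≤ 2 * (p ^ 2 * r ^ 2 + V ^ 2) := by
          exact add_sq_le.trans (by linarith)
        calc _ ≤ _ := e4
          _ = c ^ 2 * (n * δ / l * r ^ 2 + d / l * r ^ 2) ^ 2 := mul_pow _ _ _
          _ ≤ c ^ 2 * (2 * (p ^ 2 * r ^ 2 + V ^ 2)) := by gcongr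
          _ = _ := by ring
    have hx : (r * b₂) ^ 2 ≤ c ^ 2 * (p ^ 2 * r ^ 2) := by
      calc (r * b₂) ^ 2 ≤ (r * (c * p)) ^ 2 := by gcongr
        _ = _ := by ring
    have hb3 : b₃ ^ 2 ≤ c ^ 2 * V ^ 2 := by
      calc b₃ ^ 2 ≤ (c * V) ^ 2 := by gcongr
        _ = _ := by ring
    have hε2 : ε ^ 2 ≤ 3 * ((b₁ * r ^ 2) ^ 2 + 4 * (r * b₂) ^ 2 + b₃ ^ 2) := by
      rw [hε, ← sub_nonneg]
      have := add_nonneg (add_nonneg (sq_nonneg (b₁ * r ^ 2 - 2 * r * b₂))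
        (sq_nonneg (b₁ * r ^ 2 - b₃))) (sq_nonneg (2 * r * b₂ - b₃))
      refine this.trans (le_of_eq (by ring))
    have hpos : 0 ≤ c ^ 2 * (p ^ 2 * r ^ 2) := by positivity
    have hpos3 : 0 ≤ c ^ 2 * V ^ 2 := by positivity
    have hfin : L * r ^ 2 ≤ 432 * c ^ 2 * (p ^ 2 * r ^ 2 + V ^ 2) := by linarith
    refine ⟨?_, by linarith⟩
    refine le_of_mul_le_mul_right (hfin.trans ?_) hr2
    have e1 : p ^ 2 * r ^ 2 ≤ V * r ^ 2 := by rw [hp2]; gcongr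
    have e2 : V ^ 2 ≤ V * r ^ 2 := by rw [sq]; gcongr
    calc 432 * c ^ 2 * (p ^ 2 * r ^ 2 + V ^ 2) ≤ 432 * c ^ 2 * (V * r ^ 2 + V * r ^ 2) := by gcongr
      _ = _ := by ring

/-- Here a = δd/n. The first inequality is used for weak signals; for larger r the second is divided
by r², which turns the term a^(2/3) r^(4/3) of V² into (a/r)^(2/3). The last bound needs only V² ≤
q. -/
theorem three_rates {q a r V K L : ℝ} (hq : 0 < q) (ha : 0 ≤ a) (hr : 0 ≤ r)
    (hK : 0 ≤ K) (hVa : V ^ 2 ≤ 2 * (q ^ 2 + a + a ^ (2 / 3 : ℝ) * r ^ (4 / 3 : ℝ) + q * r ^ 2))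
    (hVq : V ^ 2 ≤ q) (h1 : L ≤ K * V) (h2 : L * r ^ 2 ≤ K * (q * r ^ 2 + V ^ 2)) :
    L ≤ 8 * K * (√a + q) ∧ (0 < r → √a ≤ r ^ 2 → L ≤ 8 * K * (q + (a / r) ^ (2 / 3 : ℝ))) ∧
      (0 < r → L ≤ 8 * K * (q + q / r ^ 2)) := by
  -- Writing a = α³ and r = ρ³ turns the fractional powers into integer ones.
  obtain ⟨α, hα0, rfl⟩ : ∃ α : ℝ, 0 ≤ α ∧ α ^ 3 = a :=
    ⟨a ^ (1 / 3 : ℝ), by positivity, by rw [← Real.rpow_natCast, ← Real.rpow_mul ha]; norm_num⟩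
  obtain ⟨ρ, hρ0, rfl⟩ : ∃ ρ : ℝ, 0 ≤ ρ ∧ ρ ^ 3 = r :=
    ⟨r ^ (1 / 3 : ℝ), by positivity, by rw [← Real.rpow_natCast, ← Real.rpow_mul hr]; norm_num⟩
  have eα : (α ^ 3) ^ (2 / 3 : ℝ) = α ^ 2 := by
    rw [← Real.rpow_natCast, ← Real.rpow_mul hα0, ← Real.rpow_natCast]; norm_num
  have eρ : (ρ ^ 3) ^ (4 / 3 : ℝ) = ρ ^ 4 := by
    rw [← Real.rpow_natCast, ← Real.rpow_mul hρ0, ← Real.rpow_natCast]; norm_num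
  have eαρ : (α ^ 3 / ρ ^ 3) ^ (2 / 3 : ℝ) = (α / ρ) ^ 2 := by
    rw [← div_pow, ← Real.rpow_natCast, ← Real.rpow_mul (by positivity), ← Real.rpow_natCast]
    norm_num
  rw [eα, eρ] at hVa
  rw [eαρ]
  set s := √(α ^ 3) with hs
  have hs0 : 0 ≤ s := Real.sqrt_nonneg _
  have hs2 : s ^ 2 = α ^ 3 := Real.sq_sqrt ha
  have middle : 0 < ρ → s ≤ (ρ ^ 3) ^ 2 → L ≤ 8 * K * (q + (α / ρ) ^ 2) := by
    intro hρ hsr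
    have hαρ : α ≤ ρ ^ 4 := by
      refine le_of_pow_le_pow_left₀ (n := 3) (by norm_num) (by positivity) ?_
      rw [← hs2]
      calc s ^ 2 ≤ ((ρ ^ 3) ^ 2) ^ 2 := by gcongr
        _ = _ := by ring
    have hab : α ^ 3 ≤ α ^ 2 * ρ ^ 4 := by rw [pow_succ]; gcongr
    rcases le_total ((ρ ^ 3) ^ 2) q with hrq | hrq
    · have hb : α ^ 2 * ρ ^ 4 ≤ q ^ 2 := by
        calc α ^ 2 * ρ ^ 4 ≤ (ρ ^ 4) ^ 2 * ρ ^ 4 := by gcongr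
          _ = ((ρ ^ 3) ^ 2) ^ 2 := by ring
          _ ≤ q ^ 2 := by gcongr
      have hV8 : V ≤ 8 * q := by
        refine le_of_sq_le_sq ?_ (by positivity)
        have : q * (ρ ^ 3) ^ 2 ≤ q * q := by gcongr
        nlinarith
      calc L ≤ K * V := h1
        _ ≤ K * (8 * q) := by gcongr
        _ ≤ K * (8 * (q + (α / ρ) ^ 2)) := by gcongr; nlinarith [sq_nonneg (α / ρ)]
        _ = _ := by ring
    · have hr2 : 0 < (ρ ^ 3) ^ 2 := by positivity
      refine le_of_mul_le_mul_right (h2.trans ?_) hr2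
      have e : (α / ρ) ^ 2 * (ρ ^ 3) ^ 2 = α ^ 2 * ρ ^ 4 := by field_simp
      calc K * (q * (ρ ^ 3) ^ 2 + V ^ 2)
          ≤ K * (8 * (q * (ρ ^ 3) ^ 2 + (α / ρ) ^ 2 * (ρ ^ 3) ^ 2)) := by
            gcongr
            rw [e]
            have : q ^ 2 ≤ q * (ρ ^ 3) ^ 2 := by rw [sq q]; gcongr
            have : 0 ≤ α ^ 2 * ρ ^ 4 := by positivity
            nlinarith
        _ = _ := by ring
  refine ⟨?_, fun h => middle (lt_of_le_of_ne hρ0 fun h0 => by simp [← h0] at h), ?_⟩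
  · rcases le_total ((ρ ^ 3) ^ 2) s with hsr | hsr
    · have hαρ' : ρ ^ 4 ≤ α := by
        refine le_of_pow_le_pow_left₀ (n := 3) (by norm_num) hα0 ?_
        rw [← hs2]
        calc (ρ ^ 4) ^ 3 = ((ρ ^ 3) ^ 2) ^ 2 := by ring
          _ ≤ s ^ 2 := by gcongr
      have hab : α ^ 2 * ρ ^ 4 ≤ s ^ 2 := by rw [hs2, pow_succ α 2]; gcongr
      have hqs : q * (ρ ^ 3) ^ 2 ≤ q * s := by gcongr
      have hV8 : V ≤ 8 * (s + q) := by
        refine le_of_sq_le_sq ?_ (by positivity)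
        nlinarith [mul_nonneg hq.le hs0]
      calc L ≤ K * V := h1
        _ ≤ K * (8 * (s + q)) := by gcongr
        _ = _ := by ring
    · rcases hρ0.eq_or_lt with h0 | hρ
      · rw [← h0] at hsr hVa
        have hs00 : s = 0 := le_antisymm (by simpa using hsr) hs0
        have hV8 : V ≤ 8 * (s + q) := by
          refine le_of_sq_le_sq ?_ (by positivity)
          rw [← hs2, hs00] at hVa
          rw [hs00]
          nlinarith [sq_nonneg q]
        calc L ≤ K * V := h1
          _ ≤ K * (8 * (s + q)) := by gcongr
          _ = _ := by ring
      · refine (middle hρ hsr).trans ?_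
        have hαρ : α ≤ ρ ^ 4 := by
          refine le_of_pow_le_pow_left₀ (n := 3) (by norm_num) (by positivity) ?_
          rw [← hs2]
          calc s ^ 2 ≤ ((ρ ^ 3) ^ 2) ^ 2 := by gcongr
            _ = _ := by ring
        have : (α / ρ) ^ 2 ≤ s := by
          refine le_of_sq_le_sq ?_ hs0
          rw [hs2, ← pow_mul, div_pow, div_le_iff₀ (by positivity)]
          calc α ^ (2 * 2) = α ^ 3 * α := by ring
            _ ≤ α ^ 3 * ρ ^ (2 * 2) := by gcongr
        rw [add_comm s]
        gcongr
  · intro hr0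
    have hr2 : 0 < (ρ ^ 3) ^ 2 := by positivity
    refine le_of_mul_le_mul_right (h2.trans ?_) hr2
    have e : 8 * K * (q + q / (ρ ^ 3) ^ 2) * (ρ ^ 3) ^ 2 = 8 * (K * (q * (ρ ^ 3) ^ 2 + q)) := by
      rw [mul_assoc, add_mul, div_mul_cancel₀ _ hr2.ne']; ring
    rw [e]
    have : K * (q * (ρ ^ 3) ^ 2 + V ^ 2) ≤ K * (q * (ρ ^ 3) ^ 2 + q) := by gcongr
    have : 0 ≤ K * (q * (ρ ^ 3) ^ 2 + q) := by positivity
    linarith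

/-- The rates in terms of `q = d / n` imply the piecewise bounds. -/
theorem piecewise_rates {d n δ r C L : ℝ} (hd : 0 < d) (hn : 0 < n) (hdn : d ≤ n) (hδ : 0 < δ)
    (hδ' : δ < 1 / 2) (hr : 0 ≤ r) (hC : 0 ≤ C) (h1 : L ≤ C * (√(δ * d / n) + d / n))
    (h2 : 0 < r → √(δ * d / n) ≤ r ^ 2 → L ≤ C * (d / n + (δ * d / n / r) ^ (2 / 3 : ℝ)))
    (h3 : 0 < r → L ≤ C * (d / n + d / n / r ^ 2)) :
    (δ ≤ √(d / n) →
      (r ^ 2 ≤ max √(δ * d / n) (d / n) → L ≤ 2 * C * (√(δ * d / n) + d / n)) ∧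
      (d / n ≤ δ → max √(δ * d / n) (d / n) ≤ r ^ 2 → r ^ 2 ≤ max (δ ^ 2 * n / d) (d / n) →
        L ≤ 2 * C * (δ * d / n / r) ^ (2 / 3 : ℝ)) ∧
      (max (δ ^ 2 * n / d) (d / n) ≤ r ^ 2 → L ≤ 2 * C * (d / n))) ∧
    (√(d / n) ≤ δ →
      (r ^ 2 ≤ √(δ * d / n) → L ≤ 2 * C * (√(δ * d / n) + d / n)) ∧
      (√(δ * d / n) ≤ r ^ 2 → r ^ 2 ≤ √(d / n) / δ →
        L ≤ 2 * C * (δ * d / n / r) ^ (2 / 3 : ℝ)) ∧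
      (√(d / n) / δ ≤ r ^ 2 → L ≤ 2 * C * (d / n + d / n / r ^ 2))) ∧
    L ≤ 2 * C * (√(δ * d / n) + d / n) := by
  have hq : 0 < d / n := by positivity
  have hq1 : d / n ≤ 1 := (div_le_one hn).2 hdn
  have eδ : δ ^ 2 * n / d = δ ^ 2 / (d / n) := by field_simp
  rw [mul_div_assoc δ d n] at *
  rw [eδ]
  generalize d / n = q at *
  set s := √(δ * q) with hs
  have hs0 : 0 < s := by positivity
  have hs2 : s ^ 2 = δ * q := Real.sq_sqrt (by positivity)
  set p := √q with hp
  have hp0 : 0 < p := by positivity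
  have hp2 : p ^ 2 = q := Real.sq_sqrt hq.le
  have hp1 : p ≤ 1 := by nlinarith
  have pos : ∀ {x : ℝ}, 0 < x → x ≤ r ^ 2 → 0 < r := fun hx h =>
    lt_of_le_of_ne hr fun h0 => by rw [← h0] at h; norm_num at h; linarith
  set X := (δ * q / r) ^ (2 / 3 : ℝ) with hX
  have hX0 : 0 ≤ X := by positivity
  have hX3 : X ^ 3 = (δ * q / r) ^ 2 := by
    rw [hX, ← Real.rpow_natCast, ← Real.rpow_mul (by positivity), ← Real.rpow_natCast]
    norm_num
  -- The terms q and X of the middle rate cross at q r² = δ²; each regime lies on a known side of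
  -- it, and the larger term costs a factor 2.
  have hqX : 0 < r → q * r ^ 2 ≤ δ ^ 2 → q ≤ X := by
    intro hr0 h
    refine le_of_pow_le_pow_left₀ (n := 3) (by norm_num) hX0 ?_
    rw [hX3, div_pow, le_div_iff₀ (by positivity)]
    calc q ^ 3 * r ^ 2 = q ^ 2 * (q * r ^ 2) := by ring
      _ ≤ q ^ 2 * δ ^ 2 := by gcongr
      _ = _ := by ring
  have hXq : 0 < r → δ ^ 2 ≤ q * r ^ 2 → X ≤ q := by
    intro hr0 h
    refine le_of_pow_le_pow_left₀ (n := 3) (by norm_num) hq.le ?_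
    rw [hX3, div_pow, div_le_iff₀ (by positivity)]
    calc (δ * q) ^ 2 = q ^ 2 * δ ^ 2 := by ring
      _ ≤ q ^ 2 * (q * r ^ 2) := by gcongr
      _ = _ := by ring
  have g1 : L ≤ 2 * C * (s + q) := by
    have : 0 ≤ C * (s + q) := by positivity
    linarith
  have g2 : 0 < r → s ≤ r ^ 2 → q * r ^ 2 ≤ δ ^ 2 → L ≤ 2 * C * X := by
    intro hr0 hsr h
    calc L ≤ C * (q + X) := h2 hr0 hsr
      _ ≤ C * (X + X) := by gcongr; exact hqX hr0 h
      _ = _ := by ring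
  refine ⟨fun _ => ⟨fun _ => g1, fun hqδ hl hu => ?_, fun hl => ?_⟩,
    fun hpδ => ⟨fun _ => g1, fun hl hu => ?_, fun hl => ?_⟩, g1⟩
  · have hr0 := pos hs0 ((le_max_left _ _).trans hl)
    refine g2 hr0 ((le_max_left _ _).trans hl) ?_
    have h4 : q ≤ δ ^ 2 / q := by rw [le_div_iff₀ hq]; nlinarith
    rw [max_eq_left h4, le_div_iff₀ hq] at hu
    linarith
  · have hr0 := pos hq ((le_max_right _ _).trans hl)
    have hqr := (le_max_right _ _).trans hl
    have hδr := (le_max_left _ _).trans hl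
    rw [div_le_iff₀ hq] at hδr
    have hsr : s ≤ r ^ 2 := by
      rcases le_total δ q with h | h
      · refine le_of_sq_le_sq ?_ (by positivity)
        rw [hs2]
        calc δ * q ≤ q * q := by gcongr
          _ ≤ r ^ 2 * r ^ 2 := by gcongr
          _ = _ := by ring
      · refine le_of_sq_le_sq (le_of_mul_le_mul_right ?_ (by positivity : 0 < q ^ 2)) (by positivity)
        rw [hs2]
        calc δ * q * q ^ 2 = δ * q ^ 3 := by ring
          _ ≤ δ * δ ^ 3 := by gcongr
          _ = (δ ^ 2) ^ 2 := by ring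
          _ ≤ (r ^ 2 * q) ^ 2 := by gcongr
          _ = _ := by ring
    calc L ≤ C * (q + X) := h2 hr0 hsr
      _ ≤ C * (q + q) := by gcongr; exact hXq hr0 (by linarith)
      _ = _ := by ring
  · have hr0 := pos hs0 hl
    refine g2 hr0 hl ?_
    rw [le_div_iff₀ hδ] at hu
    refine le_of_mul_le_mul_right ?_ hδ
    calc q * r ^ 2 * δ = q * (r ^ 2 * δ) := by ring
      _ ≤ q * p := by gcongr
      _ = p ^ 2 * p := by rw [hp2]
      _ ≤ δ ^ 2 * δ := by gcongr
  · have hr0 := pos (by positivity) hl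
    have : 0 ≤ C * (q + q / r ^ 2) := by positivity
    linarith [h3 hr0]

/-! ### The size of the number of buckets -/

theorem rpow_div_three_pow_three {x : ℝ} (hx : 0 ≤ x) (m : ℕ) : (x ^ (m / 3 : ℝ)) ^ 3 = x ^ m := by
  rw [← Real.rpow_natCast, ← Real.rpow_mul hx, ← Real.rpow_natCast]; norm_num

theorem bucketLength_pos {n ℓ : ℕ} (h0 : 1 ≤ ℓ) (h : ℓ ≤ n) : 1 ≤ bucketLength n ℓ :=
  (Nat.one_le_div_iff h0).2 h

theorem le_two_mul_bucketLength_mul {n ℓ : ℕ} (h0 : 1 ≤ ℓ) (h : ℓ ≤ n) :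
    n ≤ 2 * (bucketLength n ℓ * ℓ) := by
  have h1 := bucketLength_pos h0 h
  have h2 := Nat.div_add_mod' n ℓ
  have h3 := Nat.mod_lt n h0
  have h4 : ℓ ≤ bucketLength n ℓ * ℓ := Nat.le_mul_of_pos_left _ h1
  unfold bucketLength at *
  omega

theorem le_numBuckets {d : ℕ} (n : ℕ) (δ : ℝ) (θ : Vec d) : d ≤ numBuckets n δ θ :=
  le_max_left _ _

theorem numBuckets_le {d n : ℕ} (h : d ≤ n) (δ : ℝ) (θ : Vec d) : numBuckets n δ θ ≤ n :=
  max_le h (min_le_right _ _)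

/-- The left side is V². Each argument of the maximum contributes one term, and the 1 lost in the
ceiling is absorbed by d ≥ 1. -/
theorem numBuckets_upper {d n : ℕ} (hd : 1 ≤ d) (hdn : d ≤ n) {δ : ℝ} (hδ : 0 < δ) (θ : Vec d) :
    (d : ℝ) * numBuckets n δ θ / n ^ 2 ≤ 2 * (((d : ℝ) / n) ^ 2 + δ * d / n
      + (δ * d / n) ^ (2 / 3 : ℝ) * ‖θ‖ ^ (4 / 3 : ℝ) + (d : ℝ) / n * ‖θ‖ ^ 2) := by
  have hd' : (1 : ℝ) ≤ d := by exact_mod_cast hd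
  have hn : (1 : ℝ) ≤ n := by exact_mod_cast hd.trans hdn
  set y := δ ^ (2 / 3 : ℝ) * (n : ℝ) ^ (4 / 3 : ℝ) * ‖θ‖ ^ (4 / 3 : ℝ) / (d : ℝ) ^ (1 / 3 : ℝ) with hy
  have hy0 : 0 ≤ y := by positivity
  have hyb : (δ * d / n) ^ (2 / 3 : ℝ) * ‖θ‖ ^ (4 / 3 : ℝ) = d * y / n ^ 2 := by
    refine (pow_left_inj₀ (by positivity) (by positivity) (n := 3) (by norm_num)).1 ?_
    have c1 := rpow_div_three_pow_three (x := δ * d / n) (by positivity) 2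
    have c2 := rpow_div_three_pow_three (norm_nonneg θ) 4
    have c3 := rpow_div_three_pow_three hδ.le 2
    have c4 := rpow_div_three_pow_three (x := n) (by positivity) 4
    have c5 := rpow_div_three_pow_three (x := d) (by positivity) 1
    push_cast at c1 c2 c3 c4 c5
    rw [hy, mul_pow, c1, c2]
    simp only [div_pow, mul_pow, c2, c3, c4, c5]
    field_simp
  have hl : (numBuckets n δ θ : ℝ) ≤ 2 * (d + n * δ + y + n * ‖θ‖ ^ 2) := by
    set x := max (max (n * δ) y) (n * ‖θ‖ ^ 2) with hx
    have hx0 : 0 ≤ x := le_max_of_le_right (by positivity)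
    have hxle : x ≤ n * δ + y + n * ‖θ‖ ^ 2 := by
      have h1 : 0 ≤ n * δ := by positivity
      have h2 : 0 ≤ n * ‖θ‖ ^ 2 := by positivity
      exact max_le (max_le (by linarith) (by linarith)) (by linarith)
    have h1 : numBuckets n δ θ ≤ max d ⌈x⌉₊ := max_le_max le_rfl (min_le_left _ _)
    have h2 : (numBuckets n δ θ : ℝ) ≤ max (d : ℝ) ⌈x⌉₊ := by exact_mod_cast h1
    have h3 := (Nat.ceil_lt_add_one hx0).le
    refine h2.trans (max_le (by linarith) (by linarith))
  rw [hyb, div_le_iff₀ (by positivity)]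
  calc (d : ℝ) * numBuckets n δ θ ≤ d * (2 * (d + n * δ + y + n * ‖θ‖ ^ 2)) := by gcongr
    _ = _ := by field_simp

/-- If the cap n is active, the buckets are single observations and there is no bias. Otherwise ℓ
dominates every argument of the maximum, and the fractional one is the solution y of d y³ =
n⁴δ²‖θ‖⁴, where bias and noise balance. -/
theorem numBuckets_lower {d n : ℕ} (hd : 1 ≤ d) (hdn : d ≤ n) {δ : ℝ} (hδ : 0 < δ) (θ : Vec d) :
    numBuckets n δ θ = n ∨
      (n : ℝ) ^ 4 * δ ^ 2 * ‖θ‖ ^ 4 ≤ d * (numBuckets n δ θ : ℝ) ^ 3 ∧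
        (n : ℝ) * ‖θ‖ ^ 2 ≤ numBuckets n δ θ := by
  have hd' : (1 : ℝ) ≤ d := by exact_mod_cast hd
  set y := δ ^ (2 / 3 : ℝ) * (n : ℝ) ^ (4 / 3 : ℝ) * ‖θ‖ ^ (4 / 3 : ℝ) / (d : ℝ) ^ (1 / 3 : ℝ) with hy
  have hy0 : 0 ≤ y := by positivity
  have hy3 : d * y ^ 3 = (n : ℝ) ^ 4 * δ ^ 2 * ‖θ‖ ^ 4 := by
    have c2 := rpow_div_three_pow_three (norm_nonneg θ) 4
    have c3 := rpow_div_three_pow_three hδ.le 2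
    have c4 := rpow_div_three_pow_three (x := n) (by positivity) 4
    have c5 := rpow_div_three_pow_three (x := d) (by positivity) 1
    push_cast at c2 c3 c4 c5
    rw [hy, div_pow, mul_pow, mul_pow, c2, c3, c4, c5]
    field_simp
  set x := max (max (n * δ) y) (n * ‖θ‖ ^ 2) with hx
  rcases le_total n ⌈x⌉₊ with h | h
  · left
    refine le_antisymm (numBuckets_le hdn δ θ) ?_
    exact le_max_of_le_right (le_min h le_rfl)
  · right
    have h1 : ⌈x⌉₊ ≤ numBuckets n δ θ := le_max_of_le_right (le_min le_rfl h)
    have h2 : x ≤ numBuckets n δ θ := (Nat.le_ceil x).trans (by exact_mod_cast h1)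
    have h3 : y ≤ numBuckets n δ θ := ((le_max_right _ _).trans (le_max_left _ _)).trans h2
    refine ⟨?_, (le_max_right _ _).trans h2⟩
    rw [← hy3]
    gcongr

/-- The deterministic part of the risk bound. -/
theorem loss_bounds_of_perturbation {d n : ℕ} (hd : 1 ≤ d) (hdn : d ≤ n) {δ : ℝ} (hδ : 0 < δ)
    (θ : Vec d) {b₁ b₂ b₃ c L : ℝ} (hc : 1 ≤ c)
    (hb₁ : 0 ≤ b₁) (hb₁' : b₁ ≤ 1)
    (hbias : numBuckets n δ θ = n → b₁ = 0)
    (hbias' : b₁ ≤ c * ((n * δ + d) / numBuckets n δ θ))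
    (hb₂ : 0 ≤ b₂) (hb₂' : b₂ ≤ c * √(d / n)) (hb₃ : 0 ≤ b₃)
    (hb₃' : b₃ ≤ c * (√(d * numBuckets n δ θ) / n))
    (h1 : L ≤ 3 * (b₁ * ‖θ‖ ^ 2 + 2 * ‖θ‖ * b₂ + b₃))
    (h2 : L * ‖θ‖ ^ 2 ≤ 24 * (b₁ * ‖θ‖ ^ 2 + 2 * ‖θ‖ * b₂ + b₃) ^ 2) :
    L ≤ 8 * (864 * c ^ 2) * (√(δ * d / n) + d / n) ∧
      (0 < ‖θ‖ → √(δ * d / n) ≤ ‖θ‖ ^ 2 →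
        L ≤ 8 * (864 * c ^ 2) * (d / n + (δ * d / n / ‖θ‖) ^ (2 / 3 : ℝ))) ∧
      (0 < ‖θ‖ → L ≤ 8 * (864 * c ^ 2) * (d / n + d / n / ‖θ‖ ^ 2)) := by
  have hd' : (0 : ℝ) < d := by exact_mod_cast hd
  have hn : (0 : ℝ) < n := by exact_mod_cast hd.trans hdn
  have hl : (d : ℝ) ≤ numBuckets n δ θ := by exact_mod_cast le_numBuckets n δ θ
  have hln : (numBuckets n δ θ : ℝ) ≤ n := by exact_mod_cast numBuckets_le hdn δ θ
  obtain ⟨r1, r2⟩ := rate_of_perturbation hd' hl hn (norm_nonneg θ) hc hb₁ hb₁' hb₂ hb₂' hb₃ hb₃'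
    ((numBuckets_lower hd hdn hδ θ).imp hbias fun h => ⟨hbias', h⟩) h1 h2
  have hV2 : (√(d * numBuckets n δ θ) / n) ^ 2 = (d : ℝ) * numBuckets n δ θ / n ^ 2 := by
    rw [div_pow, Real.sq_sqrt (by positivity)]
  refine three_rates (by positivity) (by positivity) (norm_nonneg θ) (by positivity)
    ?_ ?_ r1 (by rw [hV2]; exact r2)
  · rw [hV2]; exact numBuckets_upper hd hdn hδ θ
  · rw [hV2, div_le_div_iff₀ (by positivity) hn]
    calc (d : ℝ) * numBuckets n δ θ * n ≤ d * n * n := by gcongr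
      _ = _ := by ring

/-! ### Sign flips of the labels and the bias -/

/-- The number of sign changes of `s` between the times `0, …, m`. -/
def flipCount (s : ℕ → ℝ) (m : ℕ) : ℝ := ∑ i ∈ Finset.range m, if s (i + 1) = s i then 0 else 1

/-- Extension of a finite family to `ℕ`. -/
def extendFin {n : ℕ} (y : Fin n → ℝ) (i : ℕ) : ℝ := if h : i < n then y ⟨i, h⟩ else 1

theorem extendFin_val {n : ℕ} (y : Fin n → ℝ) (i : Fin n) : extendFin y i = y i := by
  simp [extendFin]

theorem flipCount_mono (s : ℕ → ℝ) {m m' : ℕ} (h : m ≤ m') : flipCount s m ≤ flipCount s m' :=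
  Finset.sum_le_sum_of_subset_of_nonneg (Finset.range_mono h)
    fun i _ _ => by split_ifs <;> norm_num

theorem flipCount_add (s : ℕ → ℝ) (m k : ℕ) :
    flipCount s (m + k) = flipCount s m + flipCount (fun i => s (m + i)) k := by
  simp [flipCount, Finset.sum_range_add, add_assoc]

theorem flipCount_nonneg (s : ℕ → ℝ) (m : ℕ) : 0 ≤ flipCount s m :=
  Finset.sum_nonneg fun i _ => by split_ifs <;> norm_num

theorem eq_of_flipCount_lt_one {s : ℕ → ℝ} {m : ℕ} (h : flipCount s m < 1) {i : ℕ} (hi : i ≤ m) :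
    s i = s 0 := by
  induction i with
  | zero => rfl
  | succ i ih =>
    rw [← ih (by omega)]
    by_contra hne
    have : (1 : ℝ) ≤ flipCount s m := by
      have := Finset.single_le_sum (f := fun i => if s (i + 1) = s i then (0 : ℝ) else 1)
        (fun i _ => by split_ifs <;> norm_num) (Finset.mem_range.2 (show i < m by omega))
      simpa [flipCount, hne] using this
    linarith

theorem abs_signAvg_le_one {s : ℕ → ℝ} (hs : ∀ i, s i = 1 ∨ s i = -1) {k : ℕ} (hk : 1 ≤ k) :
    |1 / (k : ℝ) * ∑ m ∈ Finset.range k, s m| ≤ 1 := by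
  have hk' : (0 : ℝ) < k := by exact_mod_cast hk
  rw [abs_mul, abs_of_pos (by positivity), one_div, inv_mul_le_iff₀ hk', mul_one]
  refine (Finset.abs_sum_le_sum_abs _ _).trans ?_
  refine (Finset.sum_le_card_nsmul _ _ 1 fun i _ => ?_).trans (by simp)
  rcases hs i with h | h <;> simp [h]

/-- Without a flip the average is ±1 and the left side vanishes; with a flip the right side is at
least 1. -/
theorem one_sub_signAvg_sq_le {s : ℕ → ℝ} (hs : ∀ i, s i = 1 ∨ s i = -1) {k : ℕ} (hk : 1 ≤ k) :
    1 - (1 / (k : ℝ) * ∑ m ∈ Finset.range k, s m) ^ 2 ≤ flipCount s (k - 1) := by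
  rcases lt_or_ge (flipCount s (k - 1)) 1 with h | h
  · have hk' : (k : ℝ) ≠ 0 := by positivity
    rw [Finset.sum_congr rfl fun i hi => eq_of_flipCount_lt_one h
      (by have := Finset.mem_range.1 hi; omega)]
    simp only [Finset.sum_const, Finset.card_range, nsmul_eq_mul]
    rw [← mul_assoc, one_div, inv_mul_cancel₀ hk', one_mul]
    rcases hs 0 with h0 | h0 <;> simp [h0, flipCount_nonneg]
  · exact (sub_le_self _ (sq_nonneg _)).trans h

/-- A block of length k has k - 1 inner transitions; the transitions between consecutive blocks are
counted only on the right. -/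
theorem sum_flipCount_block_le (s : ℕ → ℝ) (k ℓ : ℕ) (hk : 1 ≤ k) :
    ∑ i ∈ Finset.range ℓ, flipCount (fun m => s (i * k + m)) (k - 1)
      ≤ flipCount s (ℓ * k - 1) := by
  induction ℓ with
  | zero => simp [flipCount]
  | succ ℓ ih =>
    have e : (ℓ + 1) * k - 1 = ℓ * k + (k - 1) := by rw [add_mul]; omega
    rw [Finset.sum_range_succ, e, flipCount_add]
    exact add_le_add (ih.trans (flipCount_mono s (Nat.sub_le _ _))) le_rfl

theorem sum_bucket {n ℓ : ℕ} {M : Type*} [AddCommMonoid M] (f : Fin n → M) (F : ℕ → M)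
    (hF : ∀ j : Fin n, F j = f j) (i : Fin ℓ) :
    ∑ j ∈ bucket n ℓ i, f j
      = ∑ m ∈ Finset.range (bucketLength n ℓ), F (i * bucketLength n ℓ + m) := by
  have hle : (i.val + 1) * bucketLength n ℓ ≤ n :=
    (Nat.mul_le_mul_right _ i.isLt).trans (Nat.mul_div_le n ℓ)
  refine Finset.sum_bij' (fun j _ => j.val - i * bucketLength n ℓ)
    (fun m hm => ⟨i * bucketLength n ℓ + m, ?_⟩) ?_ ?_ ?_ ?_ ?_
  · have := Finset.mem_range.1 hm
    rw [add_mul] at hle; omega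
  · intro j hj
    simp only [bucket, Finset.mem_filter, add_mul] at hj
    simp only [Finset.mem_range]; omega
  · intro m hm
    have := Finset.mem_range.1 hm
    simp only [bucket, Finset.mem_filter, Finset.mem_univ, true_and, add_mul]; omega
  · intro j hj
    simp only [bucket, Finset.mem_filter, add_mul] at hj
    ext; simp only; omega
  · intro m hm
    simp
  · intro j hj
    simp only [bucket, Finset.mem_filter, add_mul] at hj
    rw [← hF]; congr 1; omega

theorem card_bucket {n ℓ : ℕ} (i : Fin ℓ) : (bucket n ℓ i).card = bucketLength n ℓ := by
  rw [Finset.card_eq_sum_ones, sum_bucket _ (fun _ => 1) (fun _ => rfl)]; simp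

theorem disjoint_bucket {n ℓ : ℕ} {i j : Fin ℓ} (hij : i ≠ j) :
    Disjoint (bucket n ℓ i) (bucket n ℓ j) := by
  rw [Finset.disjoint_left]
  intro a ha hb
  simp only [bucket, Finset.mem_filter, Finset.mem_univ, true_and] at ha hb
  apply hij
  ext
  by_contra hne
  rcases Nat.lt_or_gt_of_ne hne with h | h
  · have := Nat.mul_le_mul_right (bucketLength n ℓ) (show i.val + 1 ≤ j.val from h); omega
  · have := Nat.mul_le_mul_right (bucketLength n ℓ) (show j.val + 1 ≤ i.val from h); omega

/-- A Markov chain on two states: the sum over all paths of a product of symmetric transition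
weights. -/
theorem sum_paths_prod (g : Bool → Bool → ℝ) (c : ℝ) (hg : ∀ y, ∑ x, g x y = c) (m : ℕ) :
    ∑ b : Fin (m + 1) → Bool, ∏ i : Fin m, g (b i.castSucc) (b i.succ) = 2 * c ^ m := by
  induction m with
  | zero => simp
  | succ m ih =>
    -- The first state is summed out, which is why the hypothesis on `g` sums over its first
    -- argument.
    rw [← (Fin.consEquiv fun _ : Fin (m + 2) => Bool).sum_comp, Fintype.sum_prod_type_right]
    have : ∀ b : Fin (m + 1) → Bool, ∑ x : Bool, ∏ i : Fin (m + 1),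
        g ((Fin.consEquiv fun _ : Fin (m + 2) => Bool) (x, b) i.castSucc)
          ((Fin.consEquiv fun _ : Fin (m + 2) => Bool) (x, b) i.succ)
        = c * ∏ i : Fin m, g (b i.castSucc) (b i.succ) := by
      intro b
      simp_rw [Fin.prod_univ_succ, Fin.consEquiv_apply, ← Fin.succ_castSucc, Fin.cons_succ,
        Fin.castSucc_zero, Fin.cons_zero, ← Finset.sum_mul, hg]
    refine (Finset.sum_congr rfl fun b _ => this b).trans ?_
    rw [← Finset.mul_sum, ih]; ring

/-- The number of flips exceeds `2nδ + u` with probability at most `e⁻ᵘ`. -/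
theorem IsFlipChain.measure_flipCount_ge {Ω : Type*} [MeasurableSpace Ω] {μ : Measure Ω}
    [IsProbabilityMeasure μ] {n : ℕ} (hn : 1 ≤ n) {δ : ℝ} (hδ : 0 < δ) (hδ' : δ < 1 / 2)
    {η : Fin n → Ω → ℝ} (h : IsFlipChain μ δ η) (u : ℝ) :
    μ.real {ω | 2 * (n * δ) + u ≤ flipCount (extendFin fun i => η i ω) (n - 1)}
      ≤ Real.exp (-u) := by
  classical
  obtain ⟨m, rfl⟩ : ∃ m, n = m + 1 := ⟨n - 1, by omega⟩
  rw [Nat.add_sub_cancel]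
  set T := 2 * (((m + 1 : ℕ) : ℝ) * δ) + u with hT
  let sg : Bool → ℝ := fun b => if b then 1 else -1
  have sg_inj : ∀ x y, sg x = sg y ↔ x = y := by
    intro x y; cases x <;> cases y <;> norm_num [sg]
  let S : (Fin (m + 1) → Bool) → ℕ → ℝ := fun b => extendFin fun i => sg (b i)
  have hS : ∀ b i, S b i = 1 ∨ S b i = -1 := by
    intro b i
    simp only [S, extendFin, sg]
    split_ifs <;> simp
  let Ev : (Fin (m + 1) → Bool) → Set Ω := fun b => {ω | ∀ i : Fin (m + 1), η i ω = S b i}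
  -- The law is given path by path, so the event is covered by the finitely many sign paths with at
  -- least T flips.
  have hsub : {ω | T ≤ flipCount (extendFin fun i => η i ω) m}
      ⊆ ⋃ b ∈ Finset.univ.filter (fun b => T ≤ flipCount (S b) m), Ev b := by
    intro ω hω
    have key : (fun i => η i ω) = fun i => sg (decide (η i ω = 1)) := by
      ext i
      rcases h.sign i ω with h1 | h1 <;> norm_num [h1, sg]
    simp only [Set.mem_iUnion, Finset.mem_filter, Finset.mem_univ, true_and, exists_prop]
    refine ⟨fun i => decide (η i ω = 1), ?_, fun i => ?_⟩
    · simp only [S, ← key]; exact hω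
    · simp only [S, extendFin_val]
      exact congrFun key i
  -- Chernoff's bound with parameter 1: each flip is weighted by e, and the tilted weights still
  -- have constant sums 1 + (e - 1)δ ≤ exp(2δ).
  let g : Bool → Bool → ℝ := fun x y => if y = x then 1 - δ else δ * Real.exp 1
  have hg : ∀ y, ∑ x, g x y = 1 - δ + δ * Real.exp 1 := by
    intro y; cases y <;> simp [g]; ring
  have hprod : ∀ b, Real.exp (flipCount (S b) m) * ∏ i ∈ Finset.range m,
      (if S b (i + 1) = S b i then 1 - δ else δ)
      = ∏ i : Fin m, g (b i.castSucc) (b i.succ) := by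
    intro b
    rw [flipCount, Real.exp_sum, ← Finset.prod_mul_distrib, Finset.prod_range]
    refine Finset.prod_congr rfl fun i _ => ?_
    have e1 : S b i = sg (b i.castSucc) := extendFin_val (fun i => sg (b i)) i.castSucc
    have e2 : S b (i + 1) = sg (b i.succ) := extendFin_val (fun i => sg (b i)) i.succ
    rw [e1, e2]
    simp only [sg_inj, g]
    split_ifs <;> simp [mul_comm]
  have hpos : ∀ b, 0 ≤ ∏ i ∈ Finset.range m, (if S b (i + 1) = S b i then 1 - δ else δ) :=
    fun b => Finset.prod_nonneg fun i _ => by split_ifs <;> linarith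
  calc μ.real {ω | T ≤ flipCount (extendFin fun i => η i ω) m}
      ≤ μ.real (⋃ b ∈ Finset.univ.filter (fun b => T ≤ flipCount (S b) m), Ev b) :=
        measureReal_mono hsub (measure_ne_top _ _)
    _ ≤ ∑ b ∈ Finset.univ.filter (fun b => T ≤ flipCount (S b) m), μ.real (Ev b) :=
        measureReal_biUnion_finset_le _ _
    _ ≤ ∑ b ∈ Finset.univ.filter (fun b => T ≤ flipCount (S b) m),
          1 / 2 * Real.exp (-T) * ∏ i : Fin m, g (b i.castSucc) (b i.succ) := by
        refine Finset.sum_le_sum fun b hb => ?_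
        have hb' := (Finset.mem_filter.1 hb).2
        have hlaw := h.law (S b) (hS b)
        rw [Nat.add_sub_cancel] at hlaw
        rw [hlaw, ← hprod, ← mul_assoc, mul_assoc (1 / 2), ← Real.exp_add]
        gcongr
        · exact hpos b
        · nlinarith [Real.one_le_exp (show 0 ≤ -T + flipCount (S b) m by linarith)]
    _ ≤ ∑ b : Fin (m + 1) → Bool,
          1 / 2 * Real.exp (-T) * ∏ i : Fin m, g (b i.castSucc) (b i.succ) := by
        refine Finset.sum_le_sum_of_subset_of_nonneg (Finset.subset_univ _) fun b _ _ => ?_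
        rw [← hprod]
        have := hpos b
        positivity
    _ = Real.exp (-T) * (1 - δ + δ * Real.exp 1) ^ m := by
        rw [← Finset.mul_sum, sum_paths_prod g _ hg]; ring
    _ ≤ Real.exp (-T) * Real.exp (m * (2 * δ)) := by
        rw [Real.exp_nat_mul]
        gcongr
        · have := Real.exp_pos 1; nlinarith
        · have h1 := Real.add_one_le_exp (2 * δ)
          have h2 := Real.exp_one_lt_d9
          nlinarith
    _ ≤ Real.exp (-u) := by
        rw [← Real.exp_add, hT]
        gcongr
        push_cast
        nlinarith

/-- The averages over buckets of the labels are close to `±1` when there are few flips. -/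
theorem abs_one_sub_mean_bucketAvg_sq_le {n ℓ : ℕ} (hℓ : 1 ≤ ℓ) (hℓn : ℓ ≤ n) {y : Fin n → ℝ}
    (hy : ∀ i, y i = 1 ∨ y i = -1) :
    |1 - 1 / (ℓ : ℝ) * ∑ i : Fin ℓ, bucketAvg ℓ y i ^ 2| ≤ 1 ∧
      |1 - 1 / (ℓ : ℝ) * ∑ i : Fin ℓ, bucketAvg ℓ y i ^ 2| ≤ flipCount (extendFin y) (n - 1) / ℓ ∧
      (ℓ = n → |1 - 1 / (ℓ : ℝ) * ∑ i : Fin ℓ, bucketAvg ℓ y i ^ 2| = 0) := by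
  have hk := bucketLength_pos hℓ hℓn
  have hℓ' : (0 : ℝ) < ℓ := by exact_mod_cast hℓ
  set k := bucketLength n ℓ with hkdef
  set s := extendFin y with hs
  have hs1 : ∀ i, s i = 1 ∨ s i = -1 := by
    intro i
    simp only [hs, extendFin]
    split_ifs
    · exact hy _
    -- The default value 1 of `extendFin` keeps the extension a sequence of signs.
    · exact Or.inl rfl
  have havg : ∀ i : Fin ℓ, bucketAvg ℓ y i
      = 1 / (k : ℝ) * ∑ m ∈ Finset.range k, s (i * k + m) := by
    intro i
    rw [bucketAvg, sum_bucket y s (extendFin_val y), smul_eq_mul]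
  have hle1 : ∀ i : Fin ℓ, bucketAvg ℓ y i ^ 2 ≤ 1 := by
    intro i
    rw [havg, sq_le_one_iff_abs_le_one]
    exact abs_signAvg_le_one (s := fun m => s (i * k + m)) (fun m => hs1 _) hk
  have hge : ∀ i : Fin ℓ, 1 - bucketAvg ℓ y i ^ 2 ≤ flipCount (fun m => s (i * k + m)) (k - 1) := by
    intro i
    rw [havg]
    exact one_sub_signAvg_sq_le (s := fun m => s (i * k + m)) (fun m => hs1 _) hk
  have hrew : 1 - 1 / (ℓ : ℝ) * ∑ i : Fin ℓ, bucketAvg ℓ y i ^ 2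
      = (∑ i : Fin ℓ, (1 - bucketAvg ℓ y i ^ 2)) / ℓ := by
    rw [Finset.sum_sub_distrib]
    simp only [Finset.sum_const, Finset.card_univ, Fintype.card_fin, nsmul_eq_mul, mul_one]
    field_simp
  have hnn : 0 ≤ ∑ i : Fin ℓ, (1 - bucketAvg ℓ y i ^ 2) :=
    Finset.sum_nonneg fun i _ => sub_nonneg.2 (hle1 i)
  have hflip : ∑ i : Fin ℓ, (1 - bucketAvg ℓ y i ^ 2) ≤ flipCount s (ℓ * k - 1) := by
    refine (Finset.sum_le_sum fun i _ => hge i).trans ?_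
    rw [Finset.sum_fin_eq_sum_range]
    refine (Finset.sum_le_sum fun i hi => ?_).trans (sum_flipCount_block_le s k ℓ hk)
    rw [dif_pos (Finset.mem_range.1 hi)]
  rw [hrew, abs_of_nonneg (by positivity)]
  refine ⟨?_, ?_, ?_⟩
  · rw [div_le_one hℓ']
    refine (Finset.sum_le_card_nsmul _ _ 1 fun i _ => ?_).trans (by simp)
    exact sub_le_self _ (sq_nonneg _)
  · gcongr
    refine hflip.trans (flipCount_mono s ?_)
    have : ℓ * k ≤ n := Nat.mul_div_le n ℓ
    omega
  · rintro rfl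
    have hk1 : k = 1 := by rw [hkdef, bucketLength, Nat.div_self hℓ]
    have : ∑ i : Fin ℓ, (1 - bucketAvg ℓ y i ^ 2) ≤ 0 := by
      refine Finset.sum_nonpos fun i _ => (hge i).trans ?_
      rw [hk1]; simp [flipCount]
    rw [le_antisymm this hnn, zero_div]

/-! ### Concentration of subGaussian sums and of their squares -/

section Concentration

variable {Ω : Type*} [MeasurableSpace Ω] {μ : Measure Ω}

theorem exp_le_one_add_add_sq_mul (y : ℝ) : Real.exp y ≤ 1 + y + y ^ 2 * Real.exp |y| := by
  have h := Complex.norm_exp_sub_sum_le_norm_mul_exp (y : ℂ) 2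
  simp only [Finset.sum_range_succ, Finset.sum_range_zero, pow_zero, pow_one, Nat.factorial,
    zero_add, Nat.cast_one, div_one, Nat.mul_one, Nat.succ_eq_add_one] at h
  rw [← Complex.ofReal_exp, ← Complex.ofReal_one, ← Complex.ofReal_add, ← Complex.ofReal_sub,
    Complex.norm_real, Complex.norm_real, Real.norm_eq_abs, Real.norm_eq_abs, sq_abs] at h
  linarith [(abs_le.1 h).2]

/-- From 1 + tm ≤ E exp(tX) ≤ exp(ct²/2), with equality at t = 0, the derivative -m of the
difference vanishes there. Isotropy alone does not centre the noise; this does, and makes second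
moments of sums additive. -/
theorem integral_eq_zero_of_hasSubgaussianMGF [IsProbabilityMeasure μ] {X : Ω → ℝ} {c : NNReal}
    (h : HasSubgaussianMGF X c μ) : ∫ ω, X ω ∂μ = 0 := by
  set m := ∫ ω, X ω ∂μ with hm
  have key : ∀ t : ℝ, 1 + t * m ≤ Real.exp (c * t ^ 2 / 2) := by
    intro t
    refine le_trans ?_ (h.mgf_le t)
    have e : 1 + t * m = ∫ ω, (1 + t * X ω) ∂μ := by
      rw [integral_add (integrable_const _) (h.integrable.const_mul t), integral_const_mul]
      simp [hm]
    rw [e]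
    refine integral_mono ((integrable_const _).add (h.integrable.const_mul t))
      (h.integrable_exp_mul t) fun ω => ?_
    have := Real.add_one_le_exp (t * X ω)
    simp only; linarith
  have hd : HasDerivAt (fun t : ℝ => Real.exp (c * t ^ 2 / 2) - (1 + t * m)) (-m) 0 := by
    have h1 : HasDerivAt (fun t : ℝ => (c : ℝ) * t ^ 2 / 2) 0 0 := by
      have := (((hasDerivAt_id (0 : ℝ)).pow 2).const_mul (c : ℝ)).div_const 2
      simpa using this
    have h2 : HasDerivAt (fun t : ℝ => 1 + t * m) m 0 := by
      simpa using ((hasDerivAt_id (0 : ℝ)).mul_const m).const_add 1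
    simpa using h1.exp.fun_sub h2
  have hmin : IsLocalMin (fun t : ℝ => Real.exp (c * t ^ 2 / 2) - (1 + t * m)) 0 := by
    refine Filter.Eventually.of_forall fun t => ?_
    simpa using key t
  have := hmin.hasDerivAt_eq_zero hd
  linarith

/-- A linearisation of the Gaussian exponential moment of the square. -/
theorem sqrt_pi_mul_exp_sq_div_four (x : ℝ) :
    ENNReal.ofReal (√Real.pi) * ENNReal.ofReal (Real.exp (x ^ 2 / 4))
      = ∫⁻ u : ℝ, ENNReal.ofReal (Real.exp (-u ^ 2 + u * x)) := by
  have h1 : ∀ u : ℝ, ENNReal.ofReal (Real.exp (-u ^ 2 + u * x))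
      = ENNReal.ofReal (Real.exp (x ^ 2 / 4)) *
        ENNReal.ofReal (Real.exp (-1 * (u - x / 2) ^ 2)) := by
    intro u
    rw [← ENNReal.ofReal_mul (Real.exp_pos _).le, ← Real.exp_add]
    congr 2; ring
  simp_rw [h1]
  rw [lintegral_const_mul _ (by fun_prop),
    lintegral_sub_right_eq_self (fun u : ℝ => ENNReal.ofReal (Real.exp (-1 * u ^ 2))) (x / 2),
    ← ofReal_integral_eq_lintegral_ofReal (integrable_exp_neg_mul_sq one_pos)
      (Filter.Eventually.of_forall fun _ => (Real.exp_pos _).le), integral_gaussian, div_one,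
    mul_comm]

/-- After the linearisation and Tonelli, the bound exp(u²/2) on the moment generating function
leaves ∫ exp(-u²/2) du = √(2π), to be divided by √π. -/
theorem lintegral_exp_sq_div_four_le [IsProbabilityMeasure μ] {X : Ω → ℝ} (hX : Measurable X)
    (h : HasSubgaussianMGF X 1 μ) :
    ∫⁻ ω, ENNReal.ofReal (Real.exp (X ω ^ 2 / 4)) ∂μ ≤ ENNReal.ofReal (√2) := by
  have hpi : ENNReal.ofReal (√Real.pi) ≠ 0 := by simpa using Real.pi_pos
  rw [← ENNReal.mul_le_mul_iff_right hpi ENNReal.ofReal_ne_top,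
    ← lintegral_const_mul _ (by fun_prop)]
  simp_rw [sqrt_pi_mul_exp_sq_div_four]
  rw [lintegral_lintegral_swap (by fun_prop)]
  have hu : ∀ u : ℝ, ∫⁻ ω, ENNReal.ofReal (Real.exp (-u ^ 2 + u * X ω)) ∂μ
      ≤ ENNReal.ofReal (Real.exp (-(1 / 2) * u ^ 2)) := by
    intro u
    simp_rw [Real.exp_add, ENNReal.ofReal_mul (Real.exp_pos _).le]
    rw [lintegral_const_mul _ (by fun_prop), ← ofReal_integral_eq_lintegral_ofReal
      (h.integrable_exp_mul u) (Filter.Eventually.of_forall fun _ => (Real.exp_pos _).le),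
      ← ENNReal.ofReal_mul (Real.exp_pos _).le]
    refine ENNReal.ofReal_le_ofReal ?_
    refine (mul_le_mul_of_nonneg_left (h.mgf_le u) (Real.exp_pos _).le).trans (le_of_eq ?_)
    rw [← Real.exp_add]
    congr 1
    push_cast; ring
  refine (lintegral_mono hu).trans ?_
  rw [← ofReal_integral_eq_lintegral_ofReal (integrable_exp_neg_mul_sq (by norm_num))
      (Filter.Eventually.of_forall fun _ => (Real.exp_pos _).le), integral_gaussian,
    ← ENNReal.ofReal_mul (Real.sqrt_nonneg _), ← Real.sqrt_mul Real.pi_pos.le]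
  refine le_of_eq ?_
  congr 2; ring

/-- In exp(y) ≤ 1 + y + y² exp|y| with y = s(X² - 1), the linear term has mean zero since E X² = 1.
For |s| ≤ 1/8 the quadratic remainder is at most s² times a multiple of exp(X²/4). -/
theorem lintegral_exp_centered_sq_le [IsProbabilityMeasure μ] {X : Ω → ℝ} (hX : Measurable X)
    (h : HasSubgaussianMGF X 1 μ) (h2 : ∫ ω, X ω ^ 2 ∂μ = 1) {s : ℝ} (hs : |s| ≤ 1 / 8) :
    ∫⁻ ω, ENNReal.ofReal (Real.exp (s * (X ω ^ 2 - 1))) ∂μ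
      ≤ ENNReal.ofReal (Real.exp (256 * s ^ 2)) := by
  have hlin := lintegral_exp_sq_div_four_le hX h
  have hint : Integrable (fun ω => Real.exp (X ω ^ 2 / 4)) μ := by
    refine ⟨by fun_prop, ?_⟩
    rw [hasFiniteIntegral_iff_ofReal (Filter.Eventually.of_forall fun _ => (Real.exp_pos _).le)]
    exact hlin.trans_lt ENNReal.ofReal_lt_top
  have hE : ∫ ω, Real.exp (X ω ^ 2 / 4) ∂μ ≤ √2 := by
    rw [← ENNReal.ofReal_le_ofReal_iff (Real.sqrt_nonneg _), ofReal_integral_eq_lintegral_ofReal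
      hint (Filter.Eventually.of_forall fun _ => (Real.exp_pos _).le)]
    exact hlin
  have hint2 : Integrable (fun ω => X ω ^ 2) μ := (h.memLp 2).integrable_sq
  set K := 128 * Real.exp (1 / 4) with hK
  have hpt : ∀ x : ℝ, Real.exp (s * (x ^ 2 - 1))
      ≤ 1 + s * (x ^ 2 - 1) + K * s ^ 2 * Real.exp (x ^ 2 / 4) := by
    intro x
    set w := |x ^ 2 - 1| with hw
    have hw0 : 0 ≤ w := abs_nonneg _
    have hwx : w ≤ x ^ 2 + 1 := by
      rw [hw, abs_le]; constructor <;> nlinarith [sq_nonneg x]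
    refine (exp_le_one_add_add_sq_mul _).trans ?_
    have e1 : |s * (x ^ 2 - 1)| ≤ w / 8 := by
      rw [abs_mul, ← hw]
      calc |s| * w ≤ 1 / 8 * w := by gcongr
        _ = _ := by ring
    have e2 : w ^ 2 ≤ 128 * Real.exp (w / 8) := by
      have := Real.quadratic_le_exp_of_nonneg (show 0 ≤ w / 8 by positivity)
      nlinarith
    have e3 : (s * (x ^ 2 - 1)) ^ 2 = s ^ 2 * w ^ 2 := by rw [hw, sq_abs]; ring
    have e4 : s ^ 2 * w ^ 2 * Real.exp |s * (x ^ 2 - 1)| ≤ K * s ^ 2 * Real.exp (x ^ 2 / 4) := by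
      calc s ^ 2 * w ^ 2 * Real.exp |s * (x ^ 2 - 1)|
          ≤ s ^ 2 * (128 * Real.exp (w / 8)) * Real.exp (w / 8) := by gcongr
        _ = 128 * s ^ 2 * Real.exp (w / 4) := by
          rw [mul_assoc, mul_assoc, ← Real.exp_add]; ring_nf
        _ ≤ 128 * s ^ 2 * Real.exp (1 / 4 + x ^ 2 / 4) := by
          gcongr; linarith
        _ = _ := by rw [Real.exp_add, hK]; ring
    rw [e3]; linarith
  have hrhs : Integrable (fun ω => 1 + s * (X ω ^ 2 - 1) + K * s ^ 2 * Real.exp (X ω ^ 2 / 4)) μ :=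
    ((integrable_const _).add ((hint2.sub (integrable_const _)).const_mul s)).add
      (hint.const_mul _)
  refine (lintegral_mono fun ω => ENNReal.ofReal_le_ofReal (hpt (X ω))).trans ?_
  rw [← ofReal_integral_eq_lintegral_ofReal hrhs
    (Filter.Eventually.of_forall fun ω => (Real.exp_pos _).le.trans (hpt (X ω)))]
  refine ENNReal.ofReal_le_ofReal ?_
  have e : ∫ ω, (1 + s * (X ω ^ 2 - 1) + K * s ^ 2 * Real.exp (X ω ^ 2 / 4)) ∂μ
      = 1 + K * s ^ 2 * ∫ ω, Real.exp (X ω ^ 2 / 4) ∂μ := by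
    have i1 : Integrable (fun ω => s * (X ω ^ 2 - 1)) μ :=
      (hint2.sub (integrable_const _)).const_mul s
    have i2 : Integrable (fun ω => 1 + s * (X ω ^ 2 - 1)) μ := (integrable_const _).add i1
    rw [integral_add i2 (hint.const_mul _), integral_add (integrable_const _) i1,
      integral_const_mul, integral_const_mul, integral_sub hint2 (integrable_const _), h2]
    simp
  rw [e]
  have hK2 : K * √2 ≤ 256 := by
    have h1 : Real.exp (1 / 4) * √2 ≤ 2 := by
      refine le_of_sq_le_sq ?_ (by norm_num)
      rw [mul_pow, Real.sq_sqrt (by norm_num), ← Real.exp_nat_mul]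
      refine le_of_pow_le_pow_left₀ (n := 2) (by norm_num) (by norm_num) ?_
      rw [mul_pow, ← Real.exp_nat_mul]
      have := Real.exp_one_lt_d9
      norm_num
      linarith
    rw [hK]; linarith
  calc 1 + K * s ^ 2 * ∫ ω, Real.exp (X ω ^ 2 / 4) ∂μ ≤ 1 + K * s ^ 2 * √2 := by gcongr
    _ ≤ 1 + 256 * s ^ 2 := by nlinarith [sq_nonneg s]
    _ ≤ Real.exp (256 * s ^ 2) := by linarith [Real.add_one_le_exp (256 * s ^ 2)]

/-- Functions of sums over disjoint blocks of independent variables are independent. -/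
theorem lintegral_prod_block_sums {ι κ : Type*} {Z : ι → Ω → ℝ} (hZ : iIndepFun Z μ)
    (hm : ∀ i, Measurable (Z i)) (B : κ → Finset ι)
    (hB : Pairwise fun i j => Disjoint (B i) (B j)) {φ : ℝ → ENNReal} (hφ : Measurable φ)
    (s : Finset κ) :
    ∫⁻ ω, ∏ i ∈ s, φ (∑ j ∈ B i, Z j ω) ∂μ = ∏ i ∈ s, ∫⁻ ω, φ (∑ j ∈ B i, Z j ω) ∂μ := by
  classical
  have := hZ.isProbabilityMeasure
  induction s using Finset.induction_on with
  | empty => simp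
  | insert a s ha ih =>
    have hdisj : Disjoint (B a) (s.biUnion B) := by
      rw [Finset.disjoint_biUnion_right]
      exact fun i hi => hB fun h => ha (h ▸ hi)
    have hind := hZ.indepFun_finset (B a) (s.biUnion B) hdisj hm
    have h1 : Measurable fun z : B a → ℝ => φ (∑ j, z j) := by fun_prop
    have h2 : Measurable fun z : s.biUnion B → ℝ =>
        ∏ i ∈ s, φ (∑ j ∈ B i, if h : j ∈ s.biUnion B then z ⟨j, h⟩ else 0) := by
      refine Finset.measurable_prod _ fun i _ => hφ.comp (Finset.measurable_sum _ fun j _ => ?_)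
      split_ifs <;> fun_prop
    have hind' := hind.comp h1 h2
    have e1 : ((fun z : B a → ℝ => φ (∑ j, z j)) ∘ fun ω (i : B a) => Z i ω)
        = fun ω => φ (∑ j ∈ B a, Z j ω) := by
      ext ω
      simp only [Function.comp]
      rw [Finset.sum_coe_sort (B a) fun j => Z j ω]
    have e2 : ((fun z : s.biUnion B → ℝ =>
        ∏ i ∈ s, φ (∑ j ∈ B i, if h : j ∈ s.biUnion B then z ⟨j, h⟩ else 0)) ∘
          fun ω (i : s.biUnion B) => Z i ω) = fun ω => ∏ i ∈ s, φ (∑ j ∈ B i, Z j ω) := by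
      ext ω
      simp only [Function.comp]
      refine Finset.prod_congr rfl fun i hi => ?_
      congr 1
      refine Finset.sum_congr rfl fun j hj => ?_
      rw [dif_pos (Finset.mem_biUnion.2 ⟨i, hi, hj⟩)]
    rw [e1, e2] at hind'
    rw [Finset.prod_insert ha, ← ih, ← lintegral_mul_eq_lintegral_mul_lintegral_of_indepFun
      (by fun_prop) (by fun_prop) hind']
    refine lintegral_congr fun ω => ?_
    rw [Finset.prod_insert ha, Pi.mul_apply]

/-- Chernoff's bound with a [0, ∞]-valued integral, so that no integrability of the exponential has
to be checked. -/
theorem measureReal_ge_le_of_lintegral_exp_le [IsProbabilityMeasure μ] {X : Ω → ℝ}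
    (hX : Measurable X) {s τ b : ℝ} (hs : 0 ≤ s)
    (h : ∫⁻ ω, ENNReal.ofReal (Real.exp (s * X ω)) ∂μ ≤ ENNReal.ofReal (Real.exp b)) :
    μ.real {ω | τ ≤ X ω} ≤ Real.exp (b - s * τ) := by
  have h1 := meas_ge_le_lintegral_div (μ := μ)
    (f := fun ω => ENNReal.ofReal (Real.exp (s * X ω))) (by fun_prop)
    (ε := ENNReal.ofReal (Real.exp (s * τ))) (by simpa using Real.exp_pos _) ENNReal.ofReal_ne_top
  have h2 : μ {ω | τ ≤ X ω} ≤ ENNReal.ofReal (Real.exp (b - s * τ)) := by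
    calc μ {ω | τ ≤ X ω} ≤ μ {ω | ENNReal.ofReal (Real.exp (s * τ))
          ≤ ENNReal.ofReal (Real.exp (s * X ω))} := by
          refine measure_mono fun ω hω => ENNReal.ofReal_le_ofReal (Real.exp_le_exp.2 ?_)
          exact mul_le_mul_of_nonneg_left hω hs
      _ ≤ _ := h1
      _ ≤ ENNReal.ofReal (Real.exp b) / ENNReal.ofReal (Real.exp (s * τ)) := by gcongr
      _ = _ := by rw [← ENNReal.ofReal_div_of_pos (Real.exp_pos _), ← Real.exp_sub]
  exact ENNReal.toReal_le_of_le_ofReal (Real.exp_pos _).le h2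

theorem hasSubgaussianMGF_const_mul_of_le {X : Ω → ℝ} {c c' : NNReal}
    (h : HasSubgaussianMGF X c μ) (r : ℝ) (hc : r ^ 2 * c ≤ c') :
    HasSubgaussianMGF (fun ω => r * X ω) c' μ where
  integrable_exp_mul t := by simpa only [mul_assoc] using h.integrable_exp_mul (t * r)
  mgf_le t := by
    have := h.mgf_le (t * r)
    simp only [mgf, mul_assoc] at this ⊢
    refine this.trans (Real.exp_le_exp.2 ?_)
    have := mul_le_mul_of_nonneg_right hc (sq_nonneg t)
    nlinarith

/-- Normalised sums of independent centred variables of unit variance have unit second moment. -/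
theorem integral_normalized_sum_sq [IsProbabilityMeasure μ] {ι : Type*} {Z : ι → Ω → ℝ}
    (hZ : iIndepFun Z μ) (hsub : ∀ i, HasSubgaussianMGF (Z i) 1 μ)
    (hvar : ∀ i, ∫ ω, Z i ω ^ 2 ∂μ = 1) (B : Finset ι) (hB : B.Nonempty) :
    HasSubgaussianMGF (fun ω => 1 / √(B.card : ℝ) * ∑ j ∈ B, Z j ω) 1 μ ∧
      ∫ ω, (1 / √(B.card : ℝ) * ∑ j ∈ B, Z j ω) ^ 2 ∂μ = 1 := by
  have hc : (0 : ℝ) < B.card := by exact_mod_cast hB.card_pos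
  have hS := HasSubgaussianMGF.sum_of_iIndepFun hZ (s := B) (c := fun _ => 1) fun i _ => hsub i
  constructor
  · refine hasSubgaussianMGF_const_mul_of_le hS _ (le_of_eq ?_)
    rw [div_pow, Real.sq_sqrt hc.le]
    simp [hc.ne']
  · have hmem : ∀ i ∈ B, MemLp (Z i) 2 μ := fun i _ => (hsub i).memLp 2
    have hv := IndepFun.variance_sum hmem fun i _ j _ hij => hZ.indepFun hij
    have hone : ∀ i, Var[Z i; μ] = 1 := by
      intro i
      rw [variance_eq_sub ((hsub i).memLp 2), integral_eq_zero_of_hasSubgaussianMGF (hsub i)]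
      simpa using hvar i
    simp_rw [hone] at hv
    rw [variance_eq_sub (by simpa using memLp_finsetSum' B hmem)] at hv
    have e1 : ∫ ω, (∑ i ∈ B, Z i) ω ∂μ = 0 := by
      have := integral_eq_zero_of_hasSubgaussianMGF hS
      simpa using this
    rw [e1] at hv
    simp_rw [mul_pow]
    rw [integral_const_mul]
    have e2 : ∫ ω, (∑ j ∈ B, Z j ω) ^ 2 ∂μ = B.card := by
      simpa using hv
    rw [e2, div_pow, Real.sq_sqrt hc.le]
    field_simp

/-- Bernstein's inequality for squares of block sums. -/
theorem measure_abs_sum_block_sq_ge_le [IsProbabilityMeasure μ] {ι : Type*} {Z : ι → Ω → ℝ}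
    (hZ : iIndepFun Z μ) (hm : ∀ i, Measurable (Z i))
    (hsub : ∀ i, HasSubgaussianMGF (Z i) 1 μ) (hvar : ∀ i, ∫ ω, Z i ω ^ 2 ∂μ = 1)
    {ℓ k : ℕ} (hk : 1 ≤ k) (B : Fin ℓ → Finset ι) (hB : Pairwise fun i j => Disjoint (B i) (B j))
    (hcard : ∀ i, (B i).card = k) {d : ℕ} (hd : 1 ≤ d) (hdℓ : d ≤ ℓ) :
    μ.real {ω | 56 * √((d : ℝ) * ℓ) ≤ |∑ i, ((1 / √(k : ℝ) * ∑ j ∈ B i, Z j ω) ^ 2 - 1)|}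
      ≤ 2 * Real.exp (-(3 * d)) := by
  have hd' : (0 : ℝ) < d := by exact_mod_cast hd
  have hℓ : (0 : ℝ) < ℓ := hd'.trans_le (by exact_mod_cast hdℓ)
  set S : Ω → ℝ := fun ω => ∑ i, ((1 / √(k : ℝ) * ∑ j ∈ B i, Z j ω) ^ 2 - 1) with hS
  have hSm : Measurable S := by fun_prop
  have hbound : ∀ s : ℝ, |s| ≤ 1 / 8 →
      ∫⁻ ω, ENNReal.ofReal (Real.exp (s * S ω)) ∂μ
        ≤ ENNReal.ofReal (Real.exp (ℓ * (256 * s ^ 2))) := by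
    intro s hs
    let φ : ℝ → ENNReal := fun x => ENNReal.ofReal (Real.exp (s * ((1 / √(k : ℝ) * x) ^ 2 - 1)))
    have hφ : Measurable φ := by fun_prop
    have e : ∀ ω, ENNReal.ofReal (Real.exp (s * S ω)) = ∏ i : Fin ℓ, φ (∑ j ∈ B i, Z j ω) := by
      intro ω
      rw [hS, Finset.mul_sum, Real.exp_sum,
        ENNReal.ofReal_prod_of_nonneg fun _ _ => (Real.exp_pos _).le]
    rw [lintegral_congr e, lintegral_prod_block_sums hZ hm B hB hφ, Real.exp_nat_mul, ENNReal.ofReal_pow (Real.exp_pos _).le]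
    calc _ ≤ ∏ _i : Fin ℓ, ENNReal.ofReal (Real.exp (256 * s ^ 2)) := by
          refine Finset.prod_le_prod' fun i _ => ?_
          have hne : (B i).Nonempty := by rw [← Finset.card_pos, hcard]; omega
          obtain ⟨h1, h2⟩ := integral_normalized_sum_sq hZ hsub hvar (B i) hne
          rw [hcard] at h1 h2
          exact lintegral_exp_centered_sq_le (by fun_prop) h1 h2 hs
      _ = _ := by simp
  -- Admissible because d ≤ ℓ. The exponent becomes 4d - 7d = -3d, small enough for a union over 5^d
  -- net points.
  set s := 1 / 8 * √((d : ℝ) / ℓ) with hs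
  have hq : √((d : ℝ) / ℓ) ≤ 1 := by
    exact Real.sqrt_le_one.2 ((div_le_one hℓ).2 (by exact_mod_cast hdℓ))
  have hs0 : 0 ≤ s := by positivity
  have hs1 : |s| ≤ 1 / 8 := by rw [abs_of_nonneg hs0]; linarith
  have hs2 : ℓ * (256 * s ^ 2) = 4 * d := by
    rw [hs, mul_pow, Real.sq_sqrt (by positivity)]; field_simp; norm_num
  have hsτ : s * (56 * √((d : ℝ) * ℓ)) = 7 * d := by
    have : √((d : ℝ) / ℓ) * √((d : ℝ) * ℓ) = d := by
      rw [← Real.sqrt_mul (by positivity)]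
      have : (d : ℝ) / ℓ * (d * ℓ) = d ^ 2 := by field_simp
      rw [this, Real.sqrt_sq hd'.le]
    rw [hs]; linear_combination 7 * this
  have h1 := measureReal_ge_le_of_lintegral_exp_le (τ := 56 * √((d : ℝ) * ℓ)) hSm hs0
    (hbound s hs1)
  have h2 := measureReal_ge_le_of_lintegral_exp_le (X := fun ω => -S ω)
    (τ := 56 * √((d : ℝ) * ℓ)) hSm.neg hs0
    (b := ℓ * (256 * s ^ 2)) (by
      have := hbound (-s) (by rwa [abs_neg])
      simpa only [neg_mul, mul_neg, neg_sq] using this)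
  have hexp : (ℓ : ℝ) * (256 * s ^ 2) - s * (56 * √((d : ℝ) * ℓ)) = -(3 * d) := by
    rw [hs2, hsτ]; ring
  rw [hexp] at h1 h2
  calc μ.real {ω | 56 * √((d : ℝ) * ℓ) ≤ |S ω|} ≤ μ.real ({ω | 56 * √((d : ℝ) * ℓ) ≤ S ω} ∪ {ω | 56 * √((d : ℝ) * ℓ) ≤ -S ω}) :=
        measureReal_mono (fun ω hω => le_abs.1 (show _ ≤ |S ω| from hω)) (measure_ne_top _ _)
    _ ≤ _ := measureReal_union_le _ _
    _ ≤ _ := by linarith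

/-- A tail bound that holds conditionally on each value of an independent variable holds. -/
theorem measureReal_le_of_indepFun [IsProbabilityMeasure μ] {α β : Type*} [MeasurableSpace α]
    [MeasurableSpace β] {U : Ω → α} {V : Ω → β} (hU : Measurable U) (hV : Measurable V)
    (h : IndepFun U V μ) {S : Set (α × β)} (hS : MeasurableSet S) {b : ℝ} (hb : 0 ≤ b)
    (hbd : ∀ ω, μ.real {ω' | (U ω, V ω') ∈ S} ≤ b) : μ.real {ω | (U ω, V ω) ∈ S} ≤ b := by
  have hprod := (indepFun_iff_map_prod_eq_prod_map_map hU.aemeasurable hV.aemeasurable).1 h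
  have : IsProbabilityMeasure (μ.map V) := Measure.isProbabilityMeasure_map hV.aemeasurable
  refine ENNReal.toReal_le_of_le_ofReal hb ?_
  calc μ {ω | (U ω, V ω) ∈ S} = μ.map (fun ω => (U ω, V ω)) S :=
        (Measure.map_apply (hU.prodMk hV) hS).symm
    _ = ∫⁻ ω, μ.map V (Prod.mk (U ω) ⁻¹' S) ∂μ := by
        rw [hprod, Measure.prod_apply hS, lintegral_map (measurable_measure_prodMk_left hS) hU]
    _ ≤ ∫⁻ _, ENNReal.ofReal b ∂μ := by
        refine lintegral_mono fun ω => ?_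
        rw [Measure.map_apply hV (measurable_prodMk_left hS)]
        exact (ENNReal.le_ofReal_iff_toReal_le (measure_ne_top _ _) hb).2 (hbd ω)
    _ = _ := by simp

end Concentration

/-! ### Noise and cross terms in a fixed direction -/

section Noise

variable {Ω : Type*} [MeasurableSpace Ω] {μ : Measure Ω}

theorem IsSubGaussianVec.inner {d : ℕ} {X : Ω → Vec d} (h : IsSubGaussianVec μ X) {x : Vec d}
    (hx : ‖x‖ = 1) : HasSubgaussianMGF (fun ω => inner ℝ x (X ω)) 1 μ where
  integrable_exp_mul t := by simpa [real_inner_smul_left] using (h (t • x)).1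
  mgf_le t := by
    have := (h (t • x)).2
    simpa [mgf, real_inner_smul_left, norm_smul, hx] using this

theorem IsIsotropicVec.integral_inner_sq {d : ℕ} {X : Ω → Vec d} (h : IsIsotropicVec μ X)
    {x : Vec d} (hx : ‖x‖ = 1) : ∫ ω, inner ℝ x (X ω) ^ 2 ∂μ = 1 := by
  have e : ∀ ω, inner ℝ x (X ω) ^ 2 = ∑ a, ∑ b, x a * x b * (X ω a * X ω b) := by
    intro ω
    rw [inner_eq_sum, sq, Finset.sum_mul_sum]
    refine Finset.sum_congr rfl fun a _ => Finset.sum_congr rfl fun b _ => by ring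
  simp_rw [e]
  rw [integral_finsetSum _ fun a _ => integrable_finsetSum _ fun b _ => (h a b).1.const_mul _]
  have e2 : ∀ a, ∫ ω, ∑ b, x a * x b * (X ω a * X ω b) ∂μ = x a * x a := by
    intro a
    rw [integral_finsetSum _ fun b _ => (h a b).1.const_mul _]
    simp_rw [integral_const_mul, (h a _).2, Matrix.one_apply]
    simp
  simp_rw [e2]
  rw [← inner_eq_sum, real_inner_self_eq_norm_sq, hx, one_pow]

theorem IsNoise.iIndepFun_inner {n d : ℕ} {ξ : Fin n → Ω → Vec d} (h : IsNoise μ ξ) (x : Vec d) :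
    iIndepFun (fun j ω => inner ℝ x (ξ j ω)) μ :=
  h.indep.comp (fun _ v => inner ℝ x v) fun _ => by fun_prop

theorem IsNoise.measurable_inner {n d : ℕ} {ξ : Fin n → Ω → Vec d} (h : IsNoise μ ξ) (x : Vec d)
    (j : Fin n) : Measurable fun ω => inner ℝ x (ξ j ω) := by
  have := h.measurable j
  fun_prop

/-- The quadratic form of the noise term, in terms of normalised bucket sums. -/
theorem noise_quad_eq {n d : ℕ} (z : Fin n → Vec d) {ℓ : ℕ} (hℓ : 1 ≤ ℓ) (hℓn : ℓ ≤ n) (x : Vec d) :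
    1 / (ℓ : ℝ) * ∑ i : Fin ℓ, inner ℝ (bucketAvg ℓ z i) x ^ 2 - 1 / (bucketLength n ℓ : ℝ)
      = 1 / ((bucketLength n ℓ : ℝ) * ℓ) * ∑ i : Fin ℓ,
        ((1 / √(bucketLength n ℓ : ℝ) * ∑ j ∈ bucket n ℓ i, inner ℝ x (z j)) ^ 2 - 1) := by
  have hk : (0 : ℝ) < bucketLength n ℓ := by exact_mod_cast bucketLength_pos hℓ hℓn
  have hℓ' : (0 : ℝ) < ℓ := by exact_mod_cast hℓ
  rw [Finset.sum_sub_distrib]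
  have e : ∀ i : Fin ℓ, inner ℝ (bucketAvg ℓ z i) x ^ 2 = 1 / (bucketLength n ℓ : ℝ) *
      (1 / √(bucketLength n ℓ : ℝ) * ∑ j ∈ bucket n ℓ i, inner ℝ x (z j)) ^ 2 := by
    intro i
    rw [bucketAvg, real_inner_smul_left, sum_inner, mul_pow, mul_pow, div_pow 1 (√_),
      Real.sq_sqrt hk.le]
    simp_rw [real_inner_comm]
    ring
  simp_rw [e]
  rw [← Finset.mul_sum]
  simp only [Finset.sum_const, Finset.card_univ, Fintype.card_fin, nsmul_eq_mul, mul_one]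
  field_simp

theorem IsNoise.measure_noise_quad_ge_le [IsProbabilityMeasure μ] {n d : ℕ}
    {ξ : Fin n → Ω → Vec d} (h : IsNoise μ ξ) {ℓ : ℕ} (hd : 1 ≤ d) (hdℓ : d ≤ ℓ) (hℓn : ℓ ≤ n)
    {x : Vec d} (hx : ‖x‖ = 1) :
    μ.real {ω | 112 * (√((d : ℝ) * ℓ) / n) ≤ |1 / (ℓ : ℝ) * ∑ i : Fin ℓ,
      inner ℝ (bucketAvg ℓ (fun j => ξ j ω) i) x ^ 2 - 1 / (bucketLength n ℓ : ℝ) * ‖x‖ ^ 2|}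
      ≤ 2 * Real.exp (-(3 * d)) := by
  have hℓ := hd.trans hdℓ
  have hk := bucketLength_pos hℓ hℓn
  have hk' : (0 : ℝ) < bucketLength n ℓ := by exact_mod_cast hk
  have hℓ' : (0 : ℝ) < ℓ := by exact_mod_cast hℓ
  have hn' : (0 : ℝ) < n := by exact_mod_cast hℓ.trans hℓn
  -- At least half of the observations are used, which costs a factor 2: 112 = 2 · 56.
  have hn2 : (n : ℝ) ≤ 2 * (bucketLength n ℓ * ℓ) := by
    exact_mod_cast le_two_mul_bucketLength_mul hℓ hℓn
  refine (measureReal_mono (fun ω hω => ?_) (measure_ne_top _ _)).trans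
    (measure_abs_sum_block_sq_ge_le (h.iIndepFun_inner x) (h.measurable_inner x)
      (fun j => (h.subGaussian j).inner hx) (fun j => (h.isotropic j).integral_inner_sq hx) hk
      (bucket n ℓ) (fun i j hij => disjoint_bucket hij) card_bucket hd hdℓ)
  simp only [Set.mem_ofPred_eq] at hω ⊢
  rw [hx, one_pow, mul_one, noise_quad_eq _ hℓ hℓn, abs_mul, abs_of_pos (by positivity)] at hω
  set S := |∑ i : Fin ℓ, ((1 / √(bucketLength n ℓ : ℝ) *
    ∑ j ∈ bucket n ℓ i, inner ℝ x (ξ j ω)) ^ 2 - 1)|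
  have hS : 0 ≤ S := abs_nonneg _
  have h1 : 1 / ((bucketLength n ℓ : ℝ) * ℓ) ≤ 2 / n := by
    rw [div_le_div_iff₀ (by positivity) hn']; linarith
  have h2 : 112 * (√((d : ℝ) * ℓ) / n) ≤ 2 / n * S := hω.trans (by gcongr)
  have h3 := mul_le_mul_of_nonneg_right h2 hn'.le
  have e1 : 112 * (√((d : ℝ) * ℓ) / n) * n = 112 * √((d : ℝ) * ℓ) := by field_simp
  have e2 : 2 / n * S * n = 2 * S := by field_simp
  rw [e1, e2] at h3
  linarith

/-- The average over the bucket that contains `j` (zero if there is none). -/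
def bucketCoef {n : ℕ} (ℓ : ℕ) (y : Fin n → ℝ) (j : Fin n) : ℝ :=
  ∑ i : Fin ℓ, if j ∈ bucket n ℓ i then bucketAvg ℓ y i else 0

theorem measurable_bucketCoef {n : ℕ} (ℓ : ℕ) (j : Fin n) :
    Measurable fun y : Fin n → ℝ => bucketCoef ℓ y j := by
  unfold bucketCoef
  refine Finset.measurable_sum _ fun i _ => ?_
  split_ifs
  · unfold bucketAvg; fun_prop
  · fun_prop

theorem abs_bucketAvg_le_one {n ℓ : ℕ} {y : Fin n → ℝ} (hy : ∀ i, y i = 1 ∨ y i = -1)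
    (i : Fin ℓ) : |bucketAvg ℓ y i| ≤ 1 := by
  rw [bucketAvg, smul_eq_mul, abs_mul, abs_of_nonneg (by positivity)]
  rcases (Nat.zero_le (bucketLength n ℓ)).eq_or_lt with h0 | h0
  · simp [← h0]
  have hk : (0 : ℝ) < bucketLength n ℓ := by exact_mod_cast h0
  rw [one_div, inv_mul_le_iff₀ hk, mul_one]
  refine (Finset.abs_sum_le_sum_abs _ _).trans ?_
  refine (Finset.sum_le_card_nsmul _ _ 1 fun j _ => ?_).trans (by simp [card_bucket])
  rcases hy j with h | h <;> simp [h]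

theorem bucketCoef_sq_le_one {n : ℕ} (ℓ : ℕ) {y : Fin n → ℝ} (hy : ∀ i, y i = 1 ∨ y i = -1)
    (j : Fin n) : bucketCoef ℓ y j ^ 2 ≤ 1 := by
  rw [sq_le_one_iff_abs_le_one, bucketCoef]
  by_cases h : ∃ i : Fin ℓ, j ∈ bucket n ℓ i
  · obtain ⟨i, hi⟩ := h
    rw [Finset.sum_eq_single i, if_pos hi]
    · exact abs_bucketAvg_le_one hy i
    · intro i' _ hne
      rw [if_neg fun hi' => Finset.disjoint_left.1 (disjoint_bucket hne) hi' hi]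
    · simp
  · push Not at h
    simp [h]

/-- Regrouping by observation exhibits a linear form in the individual noise vectors whose
coefficients depend on the labels only. -/
theorem inner_cross_eq {n d : ℕ} (y : Fin n → ℝ) (z : Fin n → Vec d) (ℓ : ℕ) (x : Vec d) :
    inner ℝ x ((1 / (ℓ : ℝ)) • ∑ i : Fin ℓ, bucketAvg ℓ y i • bucketAvg ℓ z i)
      = 1 / ((bucketLength n ℓ : ℝ) * ℓ) * ∑ j, bucketCoef ℓ y j * inner ℝ x (z j) := by
  rw [real_inner_smul_right, inner_sum]
  have e : ∀ i : Fin ℓ, inner ℝ x (bucketAvg ℓ y i • bucketAvg ℓ z i)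
      = 1 / (bucketLength n ℓ : ℝ) *
        ∑ j, (if j ∈ bucket n ℓ i then bucketAvg ℓ y i else 0) * inner ℝ x (z j) := by
    intro i
    simp_rw [ite_mul, zero_mul]
    rw [Finset.sum_ite_mem, Finset.univ_inter, ← Finset.mul_sum, real_inner_smul_right,
      bucketAvg.eq_def ℓ z, real_inner_smul_right, inner_sum]
    ring
  simp_rw [e, bucketCoef]
  rw [← Finset.mul_sum, Finset.sum_comm]
  simp_rw [Finset.sum_mul]
  rw [← mul_assoc]
  congr 1
  rw [one_div, one_div, one_div, mul_inv, mul_comm]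

/-- With the labels frozen, the sum over j is subGaussian with variance parameter at most n, so it
exceeds √(6dn) with probability at most exp(-3d). Independence of labels and noise removes the
conditioning. One side suffices, because `norm_le_of_net` needs only upper bounds. -/
theorem IsModel.measure_cross_ge_le [IsProbabilityMeasure μ] {n d : ℕ} {δ : ℝ}
    {η : Fin n → Ω → ℝ} {ξ : Fin n → Ω → Vec d} (h : IsModel μ δ η ξ) {ℓ : ℕ} (hd : 1 ≤ d)
    (hdℓ : d ≤ ℓ) (hℓn : ℓ ≤ n) {x : Vec d} (hx : ‖x‖ = 1) :
    μ.real {ω | 5 * √((d : ℝ) / n) ≤ inner ℝ x ((1 / (ℓ : ℝ)) • ∑ i : Fin ℓ,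
      bucketAvg ℓ (fun j => η j ω) i • bucketAvg ℓ (fun j => ξ j ω) i)} ≤ Real.exp (-(3 * d)) := by
  have hℓ := hd.trans hdℓ
  have hk' : (0 : ℝ) < bucketLength n ℓ := by exact_mod_cast bucketLength_pos hℓ hℓn
  have hℓ' : (0 : ℝ) < ℓ := by exact_mod_cast hℓ
  have hn' : (0 : ℝ) < n := by exact_mod_cast hℓ.trans hℓn
  have hn2 : (n : ℝ) ≤ 2 * (bucketLength n ℓ * ℓ) := by
    exact_mod_cast le_two_mul_bucketLength_mul hℓ hℓn
  let S : Set ((Fin n → ℝ) × (Fin n → Vec d)) :=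
    {p | √(6 * d * n) ≤ ∑ j, bucketCoef ℓ p.1 j * inner ℝ x (p.2 j)}
  have hS : MeasurableSet S := by
    refine measurableSet_le measurable_const (Finset.measurable_sum _ fun j _ => ?_)
    have := measurable_bucketCoef ℓ j
    fun_prop
  have hηm := h.chain.measurable
  have hξm := h.noise.measurable
  have key := measureReal_le_of_indepFun (U := fun ω i => η i ω) (V := fun ω i => ξ i ω)
    (by fun_prop) (by fun_prop) h.indep hS (Real.exp_pos (-(3 * (d : ℝ)))).le fun ω => ?_
  · refine (measureReal_mono (fun ω hω => ?_) (measure_ne_top _ _)).trans key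
    simp only [Set.mem_ofPred_eq, S] at hω ⊢
    rw [inner_cross_eq] at hω
    set T := ∑ j, bucketCoef ℓ (fun i => η i ω) j * inner ℝ x (ξ j ω)
    have hT : 0 ≤ T := by
      by_contra! hT
      have h1 : 0 ≤ 5 * √((d : ℝ) / n) := by positivity
      have h2 : 1 / ((bucketLength n ℓ : ℝ) * ℓ) * T < 0 := mul_neg_of_pos_of_neg (by positivity) hT
      linarith
    have h1 : 1 / ((bucketLength n ℓ : ℝ) * ℓ) ≤ 2 / n := by
      rw [div_le_div_iff₀ (by positivity) hn']; linarith
    have h2 : 5 * √((d : ℝ) / n) ≤ 2 / n * T := hω.trans (by gcongr)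
    have h3 := mul_le_mul_of_nonneg_right h2 hn'.le
    have e2 : 2 / n * T * n = 2 * T := by field_simp
    rw [e2] at h3
    refine le_trans ?_ (show 5 * √((d : ℝ) / n) * n / 2 ≤ T by linarith)
    -- Squared, this is 6dn ≤ (5/2)² dn.
    refine Real.sqrt_le_iff.2 ⟨by positivity, ?_⟩
    rw [div_pow, mul_pow, mul_pow, Real.sq_sqrt (by positivity)]
    have : (d : ℝ) / n * n ^ 2 = d * n := by field_simp
    nlinarith [show (0 : ℝ) ≤ d * n by positivity]
  · have hsum := HasSubgaussianMGF.sum_of_iIndepFun (μ := μ) (s := Finset.univ) (c := fun _ => 1)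
      (X := fun j ω' => bucketCoef ℓ (fun i => η i ω) j * inner ℝ x (ξ j ω'))
      ((h.noise.iIndepFun_inner x).comp (fun j v => bucketCoef ℓ (fun i => η i ω) j * v)
        fun _ => by fun_prop)
      fun j _ => hasSubgaussianMGF_const_mul_of_le ((h.noise.subGaussian j).inner hx) _
        (by simpa using bucketCoef_sq_le_one ℓ (fun i => h.chain.sign i ω) j)
    refine (hsum.measure_ge_le (Real.sqrt_nonneg (6 * d * n))).trans (le_of_eq ?_)
    rw [Real.sq_sqrt (by positivity)]
    congr 1
    simp
    field_simp
    norm_num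

end Noise

/-! ### The good event -/

/-- The noise quadratic form is controlled by its values on a net. -/
theorem noise_quad_le_of_net {n d : ℕ} (z : Fin n → Vec d) (ℓ : ℕ) (N : Set (Vec d))
    (hN1 : ∀ x ∈ N, ‖x‖ = 1) (hN2 : ∀ u, ‖u‖ = 1 → ∃ x ∈ N, ‖u - x‖ ≤ 1 / 2) {ε : ℝ}
    (h : ∀ x ∈ N, |1 / (ℓ : ℝ) * ∑ i : Fin ℓ, inner ℝ (bucketAvg ℓ z i) x ^ 2
      - 1 / (bucketLength n ℓ : ℝ) * ‖x‖ ^ 2| ≤ ε) (u : Vec d) :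
    |1 / (ℓ : ℝ) * ∑ i : Fin ℓ, inner ℝ (bucketAvg ℓ z i) u ^ 2
      - 1 / (bucketLength n ℓ : ℝ) * ‖u‖ ^ 2| ≤ 32 * ε * ‖u‖ ^ 2 := by
  let B : Vec d →ₗ[ℝ] Vec d →ₗ[ℝ] ℝ := LinearMap.mk₂ ℝ
    (fun x y => 1 / (ℓ : ℝ) * ∑ i : Fin ℓ, inner ℝ (bucketAvg ℓ z i) x * inner ℝ (bucketAvg ℓ z i) y
      - 1 / (bucketLength n ℓ : ℝ) * inner ℝ x y)
    (by intros; simp only [inner_add_right, inner_add_left, add_mul, Finset.sum_add_distrib]; ring)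
    (by
      intros
      simp only [real_inner_smul_right, real_inner_smul_left, mul_assoc, ← Finset.mul_sum,
        smul_eq_mul]
      ring)
    (by intros; simp only [inner_add_right, mul_add, Finset.sum_add_distrib]; ring)
    (by
      intros
      simp only [real_inner_smul_right, mul_left_comm _ _ (inner ℝ _ _), ← Finset.mul_sum,
        smul_eq_mul]
      ring)
  have hBval : ∀ x y, B x y = 1 / (ℓ : ℝ) * ∑ i : Fin ℓ, inner ℝ (bucketAvg ℓ z i) x *
      inner ℝ (bucketAvg ℓ z i) y - 1 / (bucketLength n ℓ : ℝ) * inner ℝ x y := fun x y => by simp [B]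
  have hdiag : ∀ x, B x x = 1 / (ℓ : ℝ) * ∑ i : Fin ℓ, inner ℝ (bucketAvg ℓ z i) x ^ 2
      - 1 / (bucketLength n ℓ : ℝ) * ‖x‖ ^ 2 := fun x => by
    rw [hBval, real_inner_self_eq_norm_sq]; simp_rw [sq]
  rw [← hdiag]
  refine abs_quad_le_of_net B (fun x y => ?_) N hN1 hN2 (fun x hx => by rw [hdiag]; exact h x hx) u
  rw [hBval, hBval, real_inner_comm]
  simp_rw [mul_comm]

theorem five_pow_mul_exp_le (d : ℕ) : (5 : ℝ) ^ d * Real.exp (-(3 * d)) ≤ Real.exp (-d) := by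
  have h1 : (5 : ℝ) ≤ Real.exp 2 := by
    have := Real.quadratic_le_exp_of_nonneg (show (0 : ℝ) ≤ 2 by norm_num)
    linarith
  calc (5 : ℝ) ^ d * Real.exp (-(3 * d)) ≤ Real.exp 2 ^ d * Real.exp (-(3 * d)) := by gcongr
    _ = Real.exp (-d) := by rw [← Real.exp_nat_mul, ← Real.exp_add]; ring_nf

/-- The three deviation bounds hold together with probability at least `1 - 4 e⁻ᵈ`. -/
theorem IsModel.exists_good_event {Ω : Type*} [MeasurableSpace Ω] {μ : Measure Ω}
    [IsProbabilityMeasure μ] {n d : ℕ} {δ : ℝ} {η : Fin n → Ω → ℝ} {ξ : Fin n → Ω → Vec d}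
    (h : IsModel μ δ η ξ) {ℓ : ℕ} (hd : 1 ≤ d) (hdℓ : d ≤ ℓ) (hℓn : ℓ ≤ n) (hδ : 0 < δ)
    (hδ' : δ < 1 / 2) :
    ∃ G : Set Ω, MeasurableSet G ∧ 1 - 4 * Real.exp (-d) ≤ μ.real G ∧ ∀ ω ∈ G,
      flipCount (extendFin fun i => η i ω) (n - 1) ≤ 2 * (n * δ) + d ∧
      ‖(1 / (ℓ : ℝ)) • ∑ i : Fin ℓ, bucketAvg ℓ (fun j => η j ω) i •
        bucketAvg ℓ (fun j => ξ j ω) i‖ ≤ 10 * √((d : ℝ) / n) ∧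
      ∀ u : Vec d, |1 / (ℓ : ℝ) * ∑ i : Fin ℓ, inner ℝ (bucketAvg ℓ (fun j => ξ j ω) i) u ^ 2
        - 1 / (bucketLength n ℓ : ℝ) * ‖u‖ ^ 2| ≤ 3584 * (√((d : ℝ) * ℓ) / n) * ‖u‖ ^ 2 := by
  obtain ⟨N, hNcard, hN1, hN2⟩ := exists_sphere_net (Vec d)
  rw [finrank_euclideanSpace_fin] at hNcard
  set b₁ : Set Ω := {ω | 2 * (n * δ) + d ≤ flipCount (extendFin fun i => η i ω) (n - 1)} with hb₁
  set b₂ : Vec d → Set Ω := fun x => {ω | 5 * √((d : ℝ) / n) ≤ inner ℝ x ((1 / (ℓ : ℝ)) •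
    ∑ i : Fin ℓ, bucketAvg ℓ (fun j => η j ω) i • bucketAvg ℓ (fun j => ξ j ω) i)} with hb₂
  set b₃ : Vec d → Set Ω := fun x => {ω | 112 * (√((d : ℝ) * ℓ) / n) ≤ |1 / (ℓ : ℝ) * ∑ i : Fin ℓ,
    inner ℝ (bucketAvg ℓ (fun j => ξ j ω) i) x ^ 2 - 1 / (bucketLength n ℓ : ℝ) * ‖x‖ ^ 2|} with hb₃
  set bad : Set Ω := b₁ ∪ ⋃ x ∈ N, (b₂ x ∪ b₃ x) with hbad
  have hprob : μ.real bad ≤ 4 * Real.exp (-d) := by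
    have h1 : μ.real b₁ ≤ Real.exp (-d) :=
      h.chain.measure_flipCount_ge ((hd.trans hdℓ).trans hℓn) hδ hδ' d
    have h2 : μ.real (⋃ x ∈ N, (b₂ x ∪ b₃ x)) ≤ 3 * Real.exp (-d) := by
      calc μ.real (⋃ x ∈ N, (b₂ x ∪ b₃ x)) ≤ ∑ x ∈ N, μ.real (b₂ x ∪ b₃ x) :=
            measureReal_biUnion_finset_le _ _
        _ ≤ ∑ _x ∈ N, 3 * Real.exp (-(3 * d)) := by
            refine Finset.sum_le_sum fun x hx => (measureReal_union_le _ _).trans ?_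
            have e1 : μ.real (b₂ x) ≤ _ := h.measure_cross_ge_le hd hdℓ hℓn (hN1 x hx)
            have e2 : μ.real (b₃ x) ≤ _ := h.noise.measure_noise_quad_ge_le hd hdℓ hℓn (hN1 x hx)
            linarith
        _ = N.card * (3 * Real.exp (-(3 * d))) := by rw [Finset.sum_const, nsmul_eq_mul]
        _ ≤ 5 ^ d * (3 * Real.exp (-(3 * d))) := by gcongr; exact_mod_cast hNcard
        _ ≤ 3 * Real.exp (-d) := by linarith [five_pow_mul_exp_le d]
    refine (measureReal_union_le _ _).trans (by linarith)
  -- Passing to a measurable hull gives a measurable event without changing the probability bound.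
  refine ⟨(toMeasurable μ bad)ᶜ, (measurableSet_toMeasurable _ _).compl, ?_, fun ω hω => ?_⟩
  · rw [probReal_compl_eq_one_sub (measurableSet_toMeasurable _ _), measureReal_def,
      measure_toMeasurable, ← measureReal_def]
    linarith
  have hω' : ω ∉ bad := fun hb => hω (subset_toMeasurable _ _ hb)
  simp only [hbad, Set.mem_union, Set.mem_iUnion, not_or, not_exists] at hω'
  obtain ⟨g1, g2⟩ := hω'
  refine ⟨(not_le.1 g1).le, ?_, fun u => ?_⟩
  -- The passage from the net to the sphere costs 2 for the vector and 32 for the form: 10 = 2 · 5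
  -- and 3584 = 32 · 112.
  · refine (norm_le_of_net N hN2 (ε := 5 * √((d : ℝ) / n)) (by positivity) _
      fun x hx => (not_le.1 (g2 x hx).1).le).trans (le_of_eq (by ring))
  · refine (noise_quad_le_of_net _ ℓ N hN1 hN2 (ε := 112 * (√((d : ℝ) * ℓ) / n))
      (fun x hx => (not_le.1 (g2 x hx).2).le) u).trans (le_of_eq (by ring))

end HiddenMarkovMixture

end

/-! ### The risk bound -/

theorem proposition2 :
    ∃ c₀ c₁ C : ℝ, 0 < c₀ ∧ 0 < c₁ ∧ 0 < C ∧
      ∀ (d n : ℕ), 1 ≤ d → d ≤ n →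
      ∀ (δ : ℝ), 0 < δ → δ < 1 / 2 →
      ∀ (θ : HiddenMarkovMixture.Vec d)
        (Ω : Type*) [MeasurableSpace Ω] (μ : Measure Ω) [IsProbabilityMeasure μ]
        (η : Fin n → Ω → ℝ) (ξ : Fin n → Ω → HiddenMarkovMixture.Vec d),
      HiddenMarkovMixture.IsModel μ δ η ξ →
      ∃ G : Set Ω, MeasurableSet G ∧ 1 - c₁ * Real.exp (-c₀ * d) ≤ μ.real G ∧
        ∀ ω ∈ G, ∀ t : HiddenMarkovMixture.Vec d,
          HiddenMarkovMixture.IsThetaTilde (HiddenMarkovMixture.observations θ η ξ ω)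
            (HiddenMarkovMixture.numBuckets n δ θ) t →
          (δ ≤ √((d : ℝ) / n) →
            (‖θ‖ ^ 2 ≤ max √(δ * d / n) ((d : ℝ) / n) →
              HiddenMarkovMixture.loss t θ ^ 2 ≤ C * (√(δ * d / n) + (d : ℝ) / n)) ∧
            ((d : ℝ) / n ≤ δ → max √(δ * d / n) ((d : ℝ) / n) ≤ ‖θ‖ ^ 2 →
              ‖θ‖ ^ 2 ≤ max (δ ^ 2 * n / d) ((d : ℝ) / n) →
              HiddenMarkovMixture.loss t θ ^ 2 ≤ C * (δ * d / n / ‖θ‖) ^ (2 / 3 : ℝ)) ∧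
            (max (δ ^ 2 * n / d) ((d : ℝ) / n) ≤ ‖θ‖ ^ 2 →
              HiddenMarkovMixture.loss t θ ^ 2 ≤ C * ((d : ℝ) / n))) ∧
          (√((d : ℝ) / n) ≤ δ →
            (‖θ‖ ^ 2 ≤ √(δ * d / n) →
              HiddenMarkovMixture.loss t θ ^ 2 ≤ C * (√(δ * d / n) + (d : ℝ) / n)) ∧
            (√(δ * d / n) ≤ ‖θ‖ ^ 2 → ‖θ‖ ^ 2 ≤ √((d : ℝ) / n) / δ →
              HiddenMarkovMixture.loss t θ ^ 2 ≤ C * (δ * d / n / ‖θ‖) ^ (2 / 3 : ℝ)) ∧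
            (√((d : ℝ) / n) / δ ≤ ‖θ‖ ^ 2 →
              HiddenMarkovMixture.loss t θ ^ 2 ≤ C * ((d : ℝ) / n + (d : ℝ) / n / ‖θ‖ ^ 2))) ∧
          HiddenMarkovMixture.loss t θ ^ 2 ≤ C * (√(δ * d / n) + (d : ℝ) / n) := by
  -- 3584 bounds all deviation constants; 864c², 8 and 2 are the losses of `rate_of_perturbation`,
  -- `three_rates` and `piecewise_rates`.
  refine ⟨1, 4, 2 * (8 * (864 * 3584 ^ 2)), one_pos, by norm_num, by norm_num, ?_⟩
  intro d n hd hdn δ hδ hδ' θ Ω _ μ _ η ξ h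
  set ℓ := HiddenMarkovMixture.numBuckets n δ θ with hℓdef
  have hdℓ : d ≤ ℓ := HiddenMarkovMixture.le_numBuckets n δ θ
  have hℓn : ℓ ≤ n := HiddenMarkovMixture.numBuckets_le hdn δ θ
  have hℓ' : (0 : ℝ) < ℓ := by exact_mod_cast hd.trans hdℓ
  have hd' : (0 : ℝ) < d := by exact_mod_cast hd
  have hdn' : (d : ℝ) ≤ n := by exact_mod_cast hdn
  obtain ⟨G, hG, hprob, hgood⟩ := h.exists_good_event hd hdℓ hℓn hδ hδ'
  refine ⟨G, hG, by simpa using hprob, fun ω hω t ht => ?_⟩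
  obtain ⟨hflip, hcross, hnoise⟩ := hgood ω hω
  obtain ⟨hA1, hA2, hA3⟩ := HiddenMarkovMixture.abs_one_sub_mean_bucketAvg_sq_le (hd.trans hdℓ) hℓn
    (y := fun i => η i ω) fun i => h.chain.sign i ω
  -- The bias enters through its exact value rather than a bound, so that it is 0 when ℓ = n.
  obtain ⟨r1, r2⟩ := HiddenMarkovMixture.loss_sq_le_of_isThetaTilde θ η ξ ω ℓ le_rfl hcross hnoise ht
  have hbias := hA2.trans (div_le_div_of_nonneg_right hflip hℓ'.le)
  have hnδ : (0 : ℝ) ≤ n * δ := by positivity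
  obtain ⟨s1, s2, s3⟩ := HiddenMarkovMixture.loss_bounds_of_perturbation hd hdn hδ θ
    (c := 3584) (by norm_num) (abs_nonneg _) hA1 hA3
    (hbias.trans (by rw [← mul_div_assoc]; gcongr; linarith)) (by positivity)
    (by gcongr; norm_num) (by positivity) le_rfl r1 r2
  exact HiddenMarkovMixture.piecewise_rates hd' (hd'.trans_le hdn') hdn' hδ hδ' (norm_nonneg θ)
    (by norm_num) s1 s2 s3
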